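/- Let $X=(X_t)_{t\ge 1}$ be a strictly stationary stochastic process with values in a finite set $\mathcal X$, and let $\pi$ be the law of $X_1$. For $\tau\ge 1$ let $$\alpha(\tau)=\sup_{t}\ \sup\bigl\{|\mathbb P(A\cap B)-\mathbb P(A)\mathbb P(B)| : A\in\sigma(X_1,\dots,X_t),\ B\in\sigma(X_{t+\tau},X_{t+\tau+1},\dots)\bigr\},$$ and assume that $X$ is exponentially $\alpha$-mixing: there are $\mu>0$ and $\rho\in(0,1)$ with $\alpha(\tau)\le\mu\rho^{\tau}$ for all $\tau\ge1$. Put $\mathsf{t_{mix}}(\varepsilon)=\min\{\tau\ge 1:\alpha(\tau)\le\varepsilon\}$. Let $n\ge1$ and $X^n=(X_1,\dots,X_n)$. For $x\in\mathcal X$ let $N_x$ be the number of $i\le n$ with $X_i=x$; for $0\le\zeta\le n$ let $\varphi_\zeta$ be the number of $x\in\mathcal X$ with $N_x=\zeta$, and let $M^\pi_\zeta=\sum_{x\in\mathcal X}\pi_x\mathbf 1\{N_x=\zeta\}$. For a window size $\tau\ge 1$ define the WingIt estimator and the plug-in estimator $$\widehat M_{\mathrm{WingIt},\zeta}(\tau)=\frac1n\sum_{i=1}^n\mathbf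 1\bigl\{\#\{k\le n:|k-i|\ge\tau,\ X_k=X_i\}=\zeta\bigr\},\qquad \widehat M_{\mathrm{PI},\zeta}=\varphi_\zeta\cdot\frac{\zeta}{n}.$$ For a transition point $\overline\zeta$ the hybrid estimator is $\widehat M_\zeta(\tau;\overline\zeta)=\nu^{-1}\widehat M_{\mathrm{WingIt},\zeta}(\tau)$ if $\zeta\le\overline\zeta$ and $\widehat M_\zeta(\tau;\overline\zeta)=\nu^{-1}\widehat M_{\mathrm{PI},\zeta}$ if $\zeta>\overline\zeta$, where $\nu>0$ is the normalizing constant that makes $\sum_{\zeta=0}^n\widehat M_\zeta(\tau;\overline\zeta)=1$. Then there is a universal constant $C>0$ (independent of the process, of $\mathcal X$, of $\mu$ and $\rho$, of $n$ and of $\tau$) such that, for every such process, every $n\ge 1$, every integer $\tau\ge\mathsf{t_{mix}}(n^{-5})$, and $\overline\zeta=\lfloor n^{1/3}\rfloor-1$, $$\mathbb E\left[\frac12\sum_{\zeta=0}^n\bigl|M^\pi_\zeta-\widehat M_\zeta(\tau;\overline\zeta)\bigr|\right]\ \le\ C\cdot\frac{\sqrt{\tau\log(Cn)}}{n^{1/6}}.$$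 -/

import Mathlib

open MeasureTheory

namespace CountMass

/-! ### The observed sequence and its count statistics

The process is `X : ℕ → Ω → S`; the variable `X t` is the `(t + 1)`-st one, so that the observed
sequence of length `n` is `(X 0, …, X (n - 1))`, a point of `Fin n → S`. -/

/-- The observed sequence of length `n` at the outcome `ω`. -/
def sample {Ω S : Type*} (X : ℕ → Ω → S) (n : ℕ) (ω : Ω) : Fin n → S :=
  fun i => X i ω

/-- The number of indices `i ∈ I` with `z i = x`. -/
def countOn {S : Type*} [DecidableEq S] {n : ℕ} (z : Fin n → S) (I : Finset (Fin n)) (x : S) : ℕ :=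
  (I.filter fun i => z i = x).card

/-- The number of occurrences of `x` in the sequence `z`. -/
def count {S : Type*} [DecidableEq S] {n : ℕ} (z : Fin n → S) (x : S) : ℕ :=
  countOn z Finset.univ x

/-- The number of symbols that occur exactly `ζ` times in `z`. -/
def numSymbols {S : Type*} [Fintype S] [DecidableEq S] {n : ℕ} (z : Fin n → S) (ζ : ℕ) : ℕ :=
  (Finset.univ.filter fun x : S => count z x = ζ).card

/-- The mass that `p` places on the symbols occurring exactly `ζ` times in `z`. -/
noncomputable def countMass {S : Type*} [Fintype S] [DecidableEq S] (p : S → ℝ) {n : ℕ}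
    (z : Fin n → S) (ζ : ℕ) : ℝ :=
  ∑ x : S, p x * (if count z x = ζ then 1 else 0)

/-! ### The estimators -/

/-- The indices at distance less than `τ` from `i`. -/
def depSet {n : ℕ} (τ : ℕ) (i : Fin n) : Finset (Fin n) :=
  Finset.univ.filter fun k => |((k : ℕ) : ℤ) - ((i : ℕ) : ℤ)| < (τ : ℤ)

/-- The indices at distance at least `τ` from `i`. -/
def indepSet {n : ℕ} (τ : ℕ) (i : Fin n) : Finset (Fin n) :=
  (depSet τ i)ᶜ

/-- The leave-a-window-out (WingIt) estimator with window size `τ`. -/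
noncomputable def wingIt {S : Type*} [DecidableEq S] (τ : ℕ) {n : ℕ} (z : Fin n → S) (ζ : ℕ) : ℝ :=
  (1 / (n : ℝ)) * ∑ i : Fin n, (if countOn z (indepSet τ i) (z i) = ζ then 1 else 0)

/-- The plug-in (empirical) estimator. -/
noncomputable def plugIn {S : Type*} [Fintype S] [DecidableEq S] {n : ℕ} (z : Fin n → S)
    (ζ : ℕ) : ℝ :=
  (numSymbols z ζ : ℝ) * ((ζ : ℝ) / (n : ℝ))

/-- The unnormalized hybrid estimator: WingIt up to the transition point `ζbar`, plug-in above. -/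
noncomputable def hybridRaw {S : Type*} [Fintype S] [DecidableEq S] (τ ζbar : ℕ) {n : ℕ}
    (z : Fin n → S) (ζ : ℕ) : ℝ :=
  if ζ ≤ ζbar then wingIt τ z ζ else plugIn z ζ

/-- The normalizing constant of the hybrid estimator. -/
noncomputable def hybridNorm {S : Type*} [Fintype S] [DecidableEq S] (τ ζbar : ℕ) {n : ℕ}
    (z : Fin n → S) : ℝ :=
  ∑ ζ ∈ Finset.range (n + 1), hybridRaw τ ζbar z ζ

/-- The (normalized) hybrid estimator. -/
noncomputable def hybrid {S : Type*} [Fintype S] [DecidableEq S] (τ ζbar : ℕ) {n : ℕ}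
    (z : Fin n → S) (ζ : ℕ) : ℝ :=
  (hybridNorm τ ζbar z)⁻¹ * hybridRaw τ ζbar z ζ

/-- Total variation distance of two mass functions on `{0, 1, …, n}`. -/
noncomputable def tvDist (n : ℕ) (p q : ℕ → ℝ) : ℝ :=
  (1 / 2) * ∑ ζ ∈ Finset.range (n + 1), |p ζ - q ζ|

/-! ### Stationary exponentially `α`-mixing processes -/

/-- Strict stationarity: all time shifts of the process have the same law on sequence space. -/
def IsStationary {Ω S : Type*} [MeasurableSpace Ω] [MeasurableSpace S] (P : Measure Ω)
    (X : ℕ → Ω → S) : Prop :=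
  ∀ k : ℕ, P.map (fun ω (t : ℕ) => X (t + k) ω) = P.map (fun ω (t : ℕ) => X t ω)

/-- The mass function of the stationary distribution, that is, of the law of the first variable. -/
noncomputable def stationaryMass {Ω S : Type*} [MeasurableSpace Ω] (P : Measure Ω)
    (X : ℕ → Ω → S) (x : S) : ℝ :=
  P.real {ω | X 0 ω = x}

/-- The σ-algebra generated by the variables up to time `t`. -/
abbrev pastSigma {Ω S : Type*} [MeasurableSpace S] (X : ℕ → Ω → S) (t : ℕ) : MeasurableSpace Ω :=
  ⨆ s ∈ Set.Iic t, MeasurableSpace.comap (X s) inferInstance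

/-- The σ-algebra generated by the variables from time `t` on. -/
abbrev futureSigma {Ω S : Type*} [MeasurableSpace S] (X : ℕ → Ω → S) (t : ℕ) : MeasurableSpace Ω :=
  ⨆ s ∈ Set.Ici t, MeasurableSpace.comap (X s) inferInstance

/-- The `α`-mixing coefficient at lag `τ`. -/
noncomputable def alphaMix {Ω S : Type*} [MeasurableSpace Ω] [MeasurableSpace S] (P : Measure Ω)
    (X : ℕ → Ω → S) (τ : ℕ) : ℝ :=
  sSup {r : ℝ | ∃ (t : ℕ) (A B : Set Ω), MeasurableSet[pastSigma X t] A ∧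
    MeasurableSet[futureSigma X (t + τ)] B ∧ r = |P.real (A ∩ B) - P.real A * P.real B|}

/-- Exponential `α`-mixing. -/
def IsExpAlphaMixing {Ω S : Type*} [MeasurableSpace Ω] [MeasurableSpace S] (P : Measure Ω)
    (X : ℕ → Ω → S) : Prop :=
  ∃ m ρ : ℝ, 0 < m ∧ 0 < ρ ∧ ρ < 1 ∧ ∀ τ : ℕ, 1 ≤ τ → alphaMix P X τ ≤ m * ρ ^ τ

/-- The mixing time to level `ε`: the least positive lag with `α`-mixing coefficient at most `ε`
(such a lag exists for every `ε > 0` when the process is exponentially `α`-mixing). -/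
noncomputable def mixTime {Ω S : Type*} [MeasurableSpace Ω] [MeasurableSpace S] (P : Measure Ω)
    (X : ℕ → Ω → S) (ε : ℝ) : ℕ :=
  sInf {τ : ℕ | 1 ≤ τ ∧ alphaMix P X τ ≤ ε}

/-! ### The risk -/

/-- The expected total variation distance between the vector of count probability masses of the
stationary distribution and the estimate `est` computed from the observed sequence. -/
noncomputable def risk {Ω S : Type*} [MeasurableSpace Ω] [Fintype S] [DecidableEq S]
    (P : Measure Ω) (X : ℕ → Ω → S) (n : ℕ) (est : (Fin n → S) → ℕ → ℝ) : ℝ :=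
  ∫ ω, tvDist n (countMass (stationaryMass P X) (sample X n ω)) (est (sample X n ω)) ∂P

end CountMass

/-!
The error of the hybrid estimator is controlled by second moments only.  With `m = ⌊n ^ (1 / 3)⌋`,
the counts below `m` are estimated by WingIt and the others by the plug-in rule, and every part of
the `ℓ¹` error is `O(√(τ / m))`.  If `τ > m` there is nothing to prove, since a total variation
distance is at most `1`.  Normalization at most doubles the `ℓ¹` error (`tvDist_hybrid_le`), so it
is enough to treat the unnormalized estimator.

The alphabet may be arbitrarily large compared with `n`, whereas `α`-mixing controls one pair of
events at a time, so sums over symbols need care.  The device is a projective norm on functions of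
two coordinate blocks (`ProjBound`): a function of projective norm `c` changes its mean by at most
`4 * α(τ) * c` when the two blocks are made independent (`IsMixingLaw.decouple`).  Averaging over
random signs shows that a diagonal sum `∑ x, u x ⊗ v x` has projective norm at most `A * B` when
`∑ x, |u x| ≤ A` and `∑ x, |v x| ≤ B` (`projBound_sum_mul`), whatever the number of symbols.  The
norm is submultiplicative, and functions of symbol counts have norms polynomial in `n`, because at
most `n` symbols occur in the sample (`projBound_sum_count`).  This is affordable since
`α(τ) ≤ n ^ (-5)`.

* The variances of the empirical frequencies add up to at most `2 * τ / n` plus a negligible term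
  (`IsMixingLaw.mean_sum_sq_deviation_le`).  This bounds the error of the plug-in rule
  (`IsMixingLaw.mean_frequent_le`) and shows that symbols of mass at least `6 * m / n` contribute
  little to the counts below `m` (`IsMixingLaw.mean_heavy_le`).
* On the symbols of mass below `6 * m / n`, the WingIt error is an average over the indices `i` of
  local errors, which compare the symbol at `i` with a fresh draw from the stationary law.  For two
  indices at distance at least `τ`, both windows are removed from all counts; this rarely changes
  anything since two given indices seldom carry the same light symbol
  (`IsMixingLaw.mean_localError_sub_le`).  Then the symbol at `i` can be decoupled from the rest,
  where its local error has mean zero (`IsMixingLaw.abs_mean_localError_mul_le`).  Hence the squared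
  errors of the `m` count masses sum to `O(τ * m / n)`, and their `ℓ¹` error is
  `O(m * √(τ / n)) = O(√(τ / m))`.
-/

namespace CountMass

/-! ### Means over a finite sample space -/

/-- The mean of `g` under the weights `Q` on a finite sample space. -/
def mean {Z : Type*} [Fintype Z] (Q : Z → ℝ) (g : Z → ℝ) : ℝ :=
  ∑ z, Q z * g z

section Mean

variable {Z : Type*} [Fintype Z] {Q : Z → ℝ}

lemma mean_add (f g : Z → ℝ) : mean Q (fun z => f z + g z) = mean Q f + mean Q g := by
  simp [mean, mul_add, Finset.sum_add_distrib]

lemma mean_sub (f g : Z → ℝ) : mean Q (fun z => f z - g z) = mean Q f - mean Q g := by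
  simp [mean, mul_sub, Finset.sum_sub_distrib]

lemma mean_const_mul (c : ℝ) (f : Z → ℝ) : mean Q (fun z => c * f z) = c * mean Q f := by
  simp only [mean, Finset.mul_sum]
  exact Finset.sum_congr rfl fun z _ => by ring

lemma mean_mul_const (c : ℝ) (f : Z → ℝ) : mean Q (fun z => f z * c) = mean Q f * c := by
  simp only [mean, Finset.sum_mul]
  exact Finset.sum_congr rfl fun z _ => by ring

lemma mean_sum {ι : Type*} (s : Finset ι) (f : ι → Z → ℝ) :
    mean Q (fun z => ∑ x ∈ s, f x z) = ∑ x ∈ s, mean Q (f x) := by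
  simp only [mean, Finset.mul_sum]
  exact Finset.sum_comm

lemma mean_const (h1 : ∑ z, Q z = 1) (c : ℝ) : mean Q (fun _ => c) = c := by
  simp [mean, ← Finset.sum_mul, h1]

lemma mean_mono (h0 : ∀ z, 0 ≤ Q z) {f g : Z → ℝ} (h : ∀ z, f z ≤ g z) :
    mean Q f ≤ mean Q g :=
  Finset.sum_le_sum fun z _ => mul_le_mul_of_nonneg_left (h z) (h0 z)

lemma abs_mean_le (h0 : ∀ z, 0 ≤ Q z) (h1 : ∑ z, Q z = 1) {f : Z → ℝ} {c : ℝ}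
    (h : ∀ z, |f z| ≤ c) : |mean Q f| ≤ c := by
  have h2 := mean_mono h0 fun z => (abs_le.1 (h z)).2
  have h3 := mean_mono h0 fun z => (abs_le.1 (h z)).1
  rw [mean_const h1] at h2 h3
  exact abs_le.2 ⟨h3, h2⟩

end Mean

/-! ### Random signs -/

/-- The sign attached to a bit. -/
def bitSign (b : Bool) : ℝ :=
  if b then 1 else -1

lemma bitSign_mul_self (b : Bool) : bitSign b * bitSign b = 1 := by
  cases b <;> simp [bitSign]

lemma abs_bitSign (b : Bool) : |bitSign b| = 1 := by
  cases b <;> simp [bitSign]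

lemma bitSign_not (b : Bool) : bitSign (!b) = -bitSign b := by
  cases b <;> simp [bitSign]

/-- Independent uniform signs are orthonormal. -/
lemma sum_bitSign_mul_bitSign {S : Type*} [Fintype S] [DecidableEq S] (x y : S) :
    ∑ e : S → Bool, bitSign (e x) * bitSign (e y) =
      if x = y then (Fintype.card (S → Bool) : ℝ) else 0 := by
  split_ifs with h
  · subst h
    simp [bitSign_mul_self]
  · -- flipping the sign at `x` negates every summand
    have key : ∑ e : S → Bool, bitSign (e x) * bitSign (e y) =
        ∑ e : S → Bool, -(bitSign (e x) * bitSign (e y)) := by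
      have hinv : Function.Involutive
          (fun e : S → Bool => Function.update e x (!e x)) := by
        intro e
        funext w
        by_cases hw : w = x
        · subst hw
          simp
        · simp [hw]
      refine Fintype.sum_equiv hinv.toPerm _ _ fun e => ?_
      have hy : y ≠ x := fun h' => h h'.symm
      simp [Function.Involutive.toPerm, hy, bitSign_not]
    rw [Finset.sum_neg_distrib] at key
    linarith

/-! ### A projective norm for functions of two sequences -/

section Proj

variable {n : ℕ} {S : Type*}

/-- `ProjBound s t F c` says that the function `F` of two sequences has projective norm at most `c`
as an element of the tensor product of the bounded functions of the coordinates in `s` of the first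
sequence and the bounded functions of the coordinates in `t` of the second one.  The norm is encoded
by duality: a linear functional of size at most `K` on the elementary tensors is of size at most
`K * c` at `F`. -/
def ProjBound (s t : Set (Fin n)) (F : (Fin n → S) → (Fin n → S) → ℝ) (c : ℝ) : Prop :=
  ∀ (Λ : ((Fin n → S) → (Fin n → S) → ℝ) →ₗ[ℝ] ℝ) (K : ℝ),
    (∀ u v : (Fin n → S) → ℝ, DependsOn u s → DependsOn v t → ∀ A B : ℝ,
      (∀ z, |u z| ≤ A) → (∀ z, |v z| ≤ B) → |Λ fun z z' => u z * v z'| ≤ K * (A * B)) →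
    |Λ F| ≤ K * c

variable {s t : Set (Fin n)} {F G : (Fin n → S) → (Fin n → S) → ℝ} {c d : ℝ}

lemma projBound_tensor {u v : (Fin n → S) → ℝ} {A B : ℝ} (hu : DependsOn u s)
    (hv : DependsOn v t) (hA : ∀ z, |u z| ≤ A) (hB : ∀ z, |v z| ≤ B) :
    ProjBound s t (fun z z' => u z * v z') (A * B) :=
  fun _ _ h => h u v hu hv A B hA hB

lemma ProjBound.add (hF : ProjBound s t F c) (hG : ProjBound s t G d) :
    ProjBound s t (fun z z' => F z z' + G z z') (c + d) := by
  intro Λ K h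
  have e : (fun z z' => F z z' + G z z') = F + G := rfl
  rw [e, map_add, mul_add]
  exact (abs_add_le _ _).trans (add_le_add (hF Λ K h) (hG Λ K h))

lemma ProjBound.sum {ι : Type*} (I : Finset ι) {F : ι → (Fin n → S) → (Fin n → S) → ℝ}
    (hF : ∀ a ∈ I, ProjBound s t (F a) c) :
    ProjBound s t (fun z z' => ∑ a ∈ I, F a z z') (I.card * c) := by
  intro Λ K h
  have e : (fun z z' => ∑ a ∈ I, F a z z') = ∑ a ∈ I, F a := by
    funext z z'
    simp
  rw [e, map_sum]
  calc |∑ a ∈ I, Λ (F a)| ≤ ∑ a ∈ I, |Λ (F a)| := Finset.abs_sum_le_sum_abs _ _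
    _ ≤ ∑ _a ∈ I, K * c := Finset.sum_le_sum fun a ha => hF a ha Λ K h
    _ = K * (I.card * c) := by
      rw [Finset.sum_const, nsmul_eq_mul]
      ring

/-- The projective norm is submultiplicative. -/
lemma ProjBound.mul (hF : ProjBound s t F c) (hG : ProjBound s t G d) :
    ProjBound s t (fun z z' => F z z' * G z z') (c * d) := by
  intro Λ K h
  -- multiplication by a fixed function is linear, which reduces to one factor at a time
  let mulBy (H : (Fin n → S) → (Fin n → S) → ℝ) :
      ((Fin n → S) → (Fin n → S) → ℝ) →ₗ[ℝ] ((Fin n → S) → (Fin n → S) → ℝ) :=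
    LinearMap.mulLeft ℝ H
  have h1 := hG (Λ.comp (mulBy F)) (K * c) (by
    intro u v hu hv A B hA hB
    have h2 := hF (Λ.comp (mulBy fun z z' => u z * v z')) (K * (A * B)) (by
      intro u' v' hu' hv' A' B' hA' hB'
      have e : (Λ.comp (mulBy fun z z' => u z * v z')) (fun z z' => u' z * v' z') =
          Λ (fun z z' => (u z * u' z) * (v z' * v' z')) := by
        simp only [LinearMap.comp_apply]
        congr 1
        funext z z'
        simp [mulBy]
        ring
      rw [e]
      refine (h (fun z => u z * u' z) (fun z => v z * v' z) ?_ ?_ (A * A') (B * B') ?_ ?_).trans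
        (le_of_eq (by ring))
      · intro x y hxy
        simp only [hu hxy, hu' hxy]
      · intro x y hxy
        simp only [hv hxy, hv' hxy]
      · intro z
        rw [abs_mul]
        exact mul_le_mul (hA z) (hA' z) (abs_nonneg _) ((abs_nonneg _).trans (hA z))
      · intro z
        rw [abs_mul]
        exact mul_le_mul (hB z) (hB' z) (abs_nonneg _) ((abs_nonneg _).trans (hB z)))
    have e : (Λ.comp (mulBy F)) (fun z z' => u z * v z') =
        (Λ.comp (mulBy fun z z' => u z * v z')) F := by
      simp only [LinearMap.comp_apply]
      congr 1
      funext z z'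
      simp [mulBy]
      ring
    rw [e]
    exact h2.trans (le_of_eq (by ring)))
  refine h1.trans (le_of_eq (by ring))

lemma ProjBound.swap (hF : ProjBound s t F c) :
    ProjBound t s (fun z z' => F z' z) c := by
  intro Λ K h
  let sw : ((Fin n → S) → (Fin n → S) → ℝ) →ₗ[ℝ] ((Fin n → S) → (Fin n → S) → ℝ) :=
    { toFun := fun H z z' => H z' z
      map_add' := fun _ _ => rfl
      map_smul' := fun _ _ => rfl }
  refine hF (Λ.comp sw) K fun u v hu hv A B hA hB => ?_
  have e : (Λ.comp sw) (fun z z' => u z * v z') = Λ (fun z z' => v z * u z') := by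
    simp only [LinearMap.comp_apply]
    congr 1
    funext z z'
    simp [sw]
    ring
  rw [e, mul_comm A B]
  exact h v u hv hu B A hB hA

variable [Fintype S] [DecidableEq S]

/-- A diagonal sum `∑ x, u x ⊗ v x` is the average over random signs `e` of the elementary tensors
`(∑ x, e x * u x) ⊗ (∑ x, e x * v x)`; hence its projective norm does not see the number of
symbols `x`. -/
lemma projBound_sum_mul {u v : S → (Fin n → S) → ℝ} {A B : ℝ}
    (hu : ∀ x, DependsOn (u x) s) (hv : ∀ x, DependsOn (v x) t)
    (hA : ∀ z, ∑ x, |u x z| ≤ A) (hB : ∀ z, ∑ x, |v x z| ≤ B) :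
    ProjBound s t (fun z z' => ∑ x, u x z * v x z') (A * B) := by
  intro Λ K h
  let T (e : S → Bool) : (Fin n → S) → (Fin n → S) → ℝ :=
    fun z z' => (∑ x, bitSign (e x) * u x z) * (∑ y, bitSign (e y) * v y z')
  have hT : ∀ e, |Λ (T e)| ≤ K * (A * B) := by
    have aux : ∀ (w : S → (Fin n → S) → ℝ) (D : ℝ), (∀ z, ∑ x, |w x z| ≤ D) →
        ∀ (e : S → Bool) z, |∑ x, bitSign (e x) * w x z| ≤ D := by
      intro w D hw e z
      refine (Finset.abs_sum_le_sum_abs _ _).trans (le_trans (le_of_eq ?_) (hw z))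
      exact Finset.sum_congr rfl fun x _ => by rw [abs_mul, abs_bitSign, one_mul]
    intro e
    refine h _ _ ?_ ?_ A B (aux u A hA e) (aux v B hB e)
    · intro z z' hz
      exact Finset.sum_congr rfl fun x _ => by rw [hu x hz]
    · intro z z' hz
      exact Finset.sum_congr rfl fun x _ => by rw [hv x hz]
  have hsum : (Fintype.card (S → Bool) : ℝ) • (fun z z' => ∑ x, u x z * v x z') =
      ∑ e, T e := by
    funext z z'
    simp only [Pi.smul_apply, Finset.sum_apply, smul_eq_mul, T]
    simp_rw [Finset.sum_mul_sum]
    rw [Finset.sum_comm, Finset.mul_sum]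
    refine Finset.sum_congr rfl fun x _ => ?_
    rw [Finset.sum_comm]
    have e1 : ∀ y, ∑ e : S → Bool, bitSign (e x) * u x z * (bitSign (e y) * v y z') =
        (if x = y then (Fintype.card (S → Bool) : ℝ) else 0) * (u x z * v y z') := by
      intro y
      rw [← sum_bitSign_mul_bitSign, Finset.sum_mul]
      exact Finset.sum_congr rfl fun e _ => by ring
    simp_rw [e1]
    simp
  have hpos : (0 : ℝ) < Fintype.card (S → Bool) := by
    exact_mod_cast Fintype.card_pos
  have h2 := congrArg Λ hsum
  rw [map_smul, map_sum, smul_eq_mul] at h2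
  have h3 : (Fintype.card (S → Bool) : ℝ) * |Λ fun z z' => ∑ x, u x z * v x z'| ≤
      Fintype.card (S → Bool) * (K * (A * B)) := by
    rw [← abs_of_pos hpos, ← abs_mul, h2, abs_of_pos hpos]
    refine (Finset.abs_sum_le_sum_abs _ _).trans ((Finset.sum_le_sum fun e _ => hT e).trans ?_)
    simp
  exact le_of_mul_le_mul_left h3 hpos

/-- If at most `n` of the counts `a x` are nonzero, then the indicator-like functions `g x (a x)`
are a constant plus a sparse family, and a diagonal sum with them has projective norm at most
`n + 1`. -/
lemma projBound_sum_count {a : S → (Fin n → S) → ℕ} {g : S → ℕ → ℝ} {v : S → (Fin n → S) → ℝ}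
    {B : ℝ} (ha : ∀ x, DependsOn (a x) s) (hv : ∀ x, DependsOn (v x) t)
    (hn : ∀ z, ∑ x, a x z ≤ n) (hg0 : ∀ x k, 0 ≤ g x k) (hg1 : ∀ x k, g x k ≤ 1)
    (hB : ∀ z, ∑ x, |v x z| ≤ B) :
    ProjBound s t (fun z z' => ∑ x, g x (a x z) * v x z') ((n + 1) * B) := by
  have h1 : ProjBound s t (fun z z' => ∑ x, (g x (a x z) - g x 0) * v x z') (n * B) := by
    refine projBound_sum_mul (u := fun x z => g x (a x z) - g x 0) ?_ hv ?_ hB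
    · intro x z z' hz
      simp only [ha x hz]
    · intro z
      have h2 : ∀ x, |g x (a x z) - g x 0| ≤ (a x z : ℝ) := by
        intro x
        rcases Nat.eq_zero_or_pos (a x z) with h | h
        · simp [h]
        · have : (1 : ℝ) ≤ a x z := by exact_mod_cast h
          have := hg0 x (a x z)
          have := hg1 x (a x z)
          have := hg0 x 0
          have := hg1 x 0
          exact abs_le.2 ⟨by linarith, by linarith⟩
      refine (Finset.sum_le_sum fun x _ => h2 x).trans ?_
      exact_mod_cast hn z
  have h2 : ProjBound s t (fun _ z' => 1 * ∑ x, g x 0 * v x z') (1 * B) := by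
    refine projBound_tensor (u := fun _ => 1) (v := fun z' => ∑ x, g x 0 * v x z')
      (fun _ _ _ => rfl) ?_ (by simp) ?_
    · intro z z' hz
      exact Finset.sum_congr rfl fun x _ => by rw [hv x hz]
    · intro z
      refine (Finset.abs_sum_le_sum_abs _ _).trans (le_trans ?_ (hB z))
      refine Finset.sum_le_sum fun x _ => ?_
      rw [abs_mul, abs_of_nonneg (hg0 x 0)]
      exact mul_le_of_le_one_left (abs_nonneg _) (hg1 x 0)
  have e : (fun z z' => ∑ x, g x (a x z) * v x z') = fun z z' =>
      (∑ x, (g x (a x z) - g x 0) * v x z') + 1 * ∑ x, g x 0 * v x z' := by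
    funext z z'
    rw [one_mul, ← Finset.sum_add_distrib]
    exact Finset.sum_congr rfl fun x _ => by ring
  rw [e, show ((n : ℝ) + 1) * B = n * B + 1 * B by ring]
  exact h1.add h2

end Proj

/-! ### Mixing laws on finite sequences -/

/-- A probability mass function `Q` on sequences of length `n` all of whose marginals are `p` and
under which bounded functions of coordinate blocks at distance at least `τ` have covariance at most
`κ`.  The earlier block is `{k | k + τ ≤ b}`, which is empty for `b < τ`. -/
structure IsMixingLaw {n : ℕ} {S : Type*} [Fintype S] [DecidableEq S]
    (Q : (Fin n → S) → ℝ) (p : S → ℝ) (τ : ℕ) (κ : ℝ) : Prop where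
  nonneg : ∀ z, 0 ≤ Q z
  sum_one : ∑ z, Q z = 1
  marginal : ∀ i x, mean Q (fun z => if z i = x then 1 else 0) = p x
  mixing : ∀ (b : ℕ) (u v : (Fin n → S) → ℝ),
    DependsOn u {k : Fin n | (k : ℕ) + τ ≤ b} → DependsOn v {k : Fin n | b ≤ (k : ℕ)} →
    ∀ A B : ℝ, (∀ z, |u z| ≤ A) → (∀ z, |v z| ≤ B) →
      |mean Q (fun z => u z * v z) - mean Q u * mean Q v| ≤ κ * (A * B)

section Counts

variable {n : ℕ} {S : Type*} [DecidableEq S]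

lemma countOn_eq_sum (z : Fin n → S) (I : Finset (Fin n)) (x : S) :
    (countOn z I x : ℝ) = ∑ i ∈ I, if z i = x then (1 : ℝ) else 0 := by
  simp [countOn]

lemma sum_countOn [Fintype S] (z : Fin n → S) (I : Finset (Fin n)) :
    ∑ x, countOn z I x = I.card :=
  (Finset.card_eq_sum_card_fiberwise fun _ _ => Finset.mem_coe.2 (Finset.mem_univ _)).symm

lemma sum_ite_eq_symbol [Fintype S] (z : Fin n → S) (i : Fin n) (f : S → ℝ) :
    ∑ x, (if z i = x then (1 : ℝ) else 0) * f x = f (z i) := by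
  simp

lemma mem_depSet {τ : ℕ} {i k : Fin n} :
    k ∈ depSet τ i ↔ (k : ℕ) < i + τ ∧ (i : ℕ) < k + τ := by
  simp only [depSet, Finset.mem_filter, Finset.mem_univ, true_and, abs_lt]
  omega

lemma mem_indepSet {τ : ℕ} {i k : Fin n} :
    k ∈ indepSet τ i ↔ (i : ℕ) + τ ≤ k ∨ (k : ℕ) + τ ≤ i := by
  rw [indepSet, Finset.mem_compl, mem_depSet]
  omega

lemma card_depSet_le (τ : ℕ) (i : Fin n) : (depSet τ i).card ≤ 2 * τ := by
  have h : (depSet τ i).card ≤ (Finset.Ico ((i : ℤ) - τ) ((i : ℤ) + τ)).card := by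
    refine Finset.card_le_card_of_injOn (fun k => ((k : ℕ) : ℤ)) ?_ ?_
    · intro k hk
      have := mem_depSet.1 hk
      simp only [Finset.coe_Ico, Set.mem_Ico]
      omega
    · intro k _ l _ h
      simpa [Fin.ext_iff] using h
  rw [Int.card_Ico] at h
  omega

end Counts

namespace IsMixingLaw

variable {n : ℕ} {S : Type*} [Fintype S] [DecidableEq S]
  {Q : (Fin n → S) → ℝ} {p : S → ℝ} {τ : ℕ} {κ : ℝ}

lemma kappa_nonneg (h : IsMixingLaw Q p τ κ) : 0 ≤ κ := by
  have h1 := h.mixing 0 (fun _ => 0) (fun _ => 0) (fun _ _ _ => rfl) (fun _ _ _ => rfl) 1 1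
    (by simp) (by simp)
  have h2 := (abs_nonneg _).trans h1
  linarith

lemma mass_nonneg (h : IsMixingLaw Q p τ κ) (hn : 1 ≤ n) (x : S) : 0 ≤ p x := by
  rw [← h.marginal ⟨0, hn⟩ x]
  refine Finset.sum_nonneg fun z _ => mul_nonneg (h.nonneg z) ?_
  dsimp only
  split_ifs <;> norm_num

lemma mass_sum_one (h : IsMixingLaw Q p τ κ) (hn : 1 ≤ n) : ∑ x, p x = 1 := by
  simp_rw [← h.marginal ⟨0, hn⟩]
  rw [← mean_sum]
  simp [mean_const h.sum_one]

/-- A function of two sequences of small projective norm has nearly the same mean on the diagonal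
as on two independent sequences. -/
lemma decouple (h : IsMixingLaw Q p τ κ) {b : ℕ} {F : (Fin n → S) → (Fin n → S) → ℝ} {c : ℝ}
    (hF : ProjBound {k : Fin n | (k : ℕ) + τ ≤ b} {k : Fin n | b ≤ (k : ℕ)} F c) :
    |mean Q (fun z => F z z) - mean Q (fun z => mean Q (fun z' => F z z'))| ≤ κ * c := by
  let Λ : ((Fin n → S) → (Fin n → S) → ℝ) →ₗ[ℝ] ℝ :=
    { toFun := fun F => mean Q (fun z => F z z) - mean Q (fun z => mean Q (fun z' => F z z'))
      map_add' := fun F G => by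
        simp only [Pi.add_apply, mean_add]
        ring
      map_smul' := fun r F => by
        simp only [Pi.smul_apply, smul_eq_mul, mean_const_mul, RingHom.id_apply]
        ring }
  refine hF Λ κ fun u v hu hv A B hA hB => ?_
  have := h.mixing b u v hu hv A B hA hB
  simpa only [Λ, LinearMap.coe_mk, AddHom.coe_mk, mean_const_mul, mean_mul_const] using this

/-- The covariances of the indicators of `z i = x` and `z j = x`, summed over any set of symbols,
are at most `κ`, the bound for a single pair of functions with values in `[0, 1]`. -/
lemma abs_coincidence_sub_le (h : IsMixingLaw Q p τ κ) (T : Finset S) {i j : Fin n}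
    (hij : j ∈ indepSet τ i) :
    |mean Q (fun z => ∑ x ∈ T, (if z i = x then (1 : ℝ) else 0) * (if z j = x then 1 else 0)) -
      ∑ x ∈ T, p x ^ 2| ≤ κ := by
  have main : ∀ i j : Fin n, (i : ℕ) + τ ≤ j →
      |mean Q (fun z => ∑ x ∈ T, (if z i = x then (1 : ℝ) else 0) * (if z j = x then 1 else 0)) -
        ∑ x ∈ T, p x ^ 2| ≤ κ := by
    intro i j hij
    have hF : ProjBound {k : Fin n | (k : ℕ) + τ ≤ j} {k : Fin n | (j : ℕ) ≤ (k : ℕ)}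
        (fun z z' => ∑ x, (if x ∈ T then (if z i = x then (1 : ℝ) else 0) else 0) *
          (if z' j = x then 1 else 0)) (1 * 1) := by
      refine projBound_sum_mul
        (u := fun x z => if x ∈ T then (if z i = x then (1 : ℝ) else 0) else 0)
        (v := fun x z' => if z' j = x then (1 : ℝ) else 0) ?_ ?_ ?_ ?_
      · intro x z z' hz
        simp only [hz i (by simpa using hij)]
      · intro x z z' hz
        simp only [hz j (by simp)]
      · intro z
        calc ∑ x, |if x ∈ T then (if z i = x then (1 : ℝ) else 0) else 0|
            ≤ ∑ x, if z i = x then (1 : ℝ) else 0 :=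
              Finset.sum_le_sum fun x _ => by split_ifs <;> simp
          _ = 1 := by simp
      · intro z
        refine le_of_eq ?_
        calc ∑ x, |if z j = x then (1 : ℝ) else 0|
            = ∑ x, if z j = x then (1 : ℝ) else 0 :=
              Finset.sum_congr rfl fun x _ => by split_ifs <;> simp
          _ = 1 := by simp
    have h1 := h.decouple hF
    have e1 : ∀ z z' : Fin n → S,
        ∑ x, (if x ∈ T then (if z i = x then (1 : ℝ) else 0) else 0) *
          (if z' j = x then 1 else 0) =
        ∑ x ∈ T, (if z i = x then (1 : ℝ) else 0) * (if z' j = x then 1 else 0) := by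
      intro z z'
      rw [← Finset.sum_filter_add_sum_filter_not Finset.univ (· ∈ T)]
      rw [Finset.sum_eq_zero (s := Finset.univ.filter fun x => ¬ x ∈ T), add_zero]
      · rw [Finset.filter_mem_eq_inter, Finset.univ_inter]
        exact Finset.sum_congr rfl fun x hx => by rw [if_pos hx]
      · intro x hx
        rw [if_neg (Finset.mem_filter.1 hx).2, zero_mul]
    simp_rw [e1, mean_sum, mean_const_mul, mean_mul_const, h.marginal, ← sq] at h1
    rw [mean_sum]
    simpa using h1
  rcases mem_indepSet.1 hij with hij | hij
  · exact main i j hij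
  · have := main j i hij
    simp_rw [mul_comm] at this ⊢
    convert this using 8

/-- The variances of the empirical frequencies are summable over the symbols: the covariances at
distance at least `τ` add up to at most `κ` by mixing, and the others contribute `2 * τ / n`. -/
lemma mean_sum_sq_deviation_le (h : IsMixingLaw Q p τ κ) (hn : 1 ≤ n) :
    mean Q (fun z => ∑ x, (count z x / n - p x) ^ 2) ≤ 2 * τ / n + κ := by
  have hn0 : (0 : ℝ) < n := by exact_mod_cast hn
  have hk := h.kappa_nonneg
  -- the diagonal second moment of the counts
  have hpair : ∀ i j : Fin n, mean Q (fun z => ∑ x,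
      (if z i = x then (1 : ℝ) else 0) * (if z j = x then 1 else 0)) ≤
      ∑ x, p x ^ 2 + κ + if j ∈ depSet τ i then 1 else 0 := by
    intro i j
    have hp2 : 0 ≤ ∑ x, p x ^ 2 := Finset.sum_nonneg fun x _ => sq_nonneg _
    split_ifs with hj
    · have : mean Q (fun z => ∑ x,
          (if z i = x then (1 : ℝ) else 0) * (if z j = x then 1 else 0)) ≤ 1 := by
        refine (mean_mono h.nonneg fun z => ?_).trans_eq (mean_const h.sum_one 1)
        rw [sum_ite_eq_symbol z i fun x => if z j = x then (1 : ℝ) else 0]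
        split_ifs <;> norm_num
      linarith
    · have := (abs_le.1 (h.abs_coincidence_sub_le Finset.univ
        (Finset.mem_compl.2 hj : j ∈ indepSet τ i))).2
      linarith
  have hsq : mean Q (fun z => ∑ x, (count z x : ℝ) ^ 2) ≤
      n ^ 2 * (∑ x, p x ^ 2 + κ) + n * (2 * τ) := by
    have e : ∀ z : Fin n → S, ∑ x, (count z x : ℝ) ^ 2 =
        ∑ i, ∑ j, ∑ x, (if z i = x then (1 : ℝ) else 0) * (if z j = x then 1 else 0) := by
      intro z
      simp_rw [count, countOn_eq_sum, sq, Finset.sum_mul_sum]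
      rw [Finset.sum_comm]
      exact Finset.sum_congr rfl fun i _ => Finset.sum_comm
    simp_rw [e]
    rw [mean_sum]
    have hi : ∀ i : Fin n, mean Q (fun z => ∑ j, ∑ x,
        (if z i = x then (1 : ℝ) else 0) * (if z j = x then 1 else 0)) ≤
        n * (∑ x, p x ^ 2 + κ) + 2 * τ := by
      intro i
      rw [mean_sum]
      refine (Finset.sum_le_sum fun j _ => hpair i j).trans ?_
      rw [Finset.sum_add_distrib, Finset.sum_boole, Finset.sum_const, Finset.card_univ,
        Fintype.card_fin, nsmul_eq_mul]
      have : ((Finset.univ.filter (· ∈ depSet τ i)).card : ℝ) ≤ 2 * τ := by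
        rw [Finset.filter_mem_eq_inter, Finset.univ_inter]
        exact_mod_cast card_depSet_le τ i
      linarith
    refine (Finset.sum_le_sum fun i _ => hi i).trans (le_of_eq ?_)
    rw [Finset.sum_const, Finset.card_univ, Fintype.card_fin, nsmul_eq_mul]
    ring
  have hmean : ∀ x, mean Q (fun z => (count z x : ℝ)) = n * p x := by
    intro x
    simp_rw [count, countOn_eq_sum]
    rw [mean_sum]
    simp [h.marginal]
  have e : (fun z : Fin n → S => ∑ x, (count z x / n - p x) ^ 2) = fun z =>
      ((1 / (n : ℝ) ^ 2) * ∑ x, (count z x : ℝ) ^ 2 -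
        ∑ x, (2 * p x / n) * (count z x : ℝ)) + ∑ x, p x ^ 2 := by
    funext z
    rw [Finset.mul_sum, ← Finset.sum_sub_distrib, ← Finset.sum_add_distrib]
    refine Finset.sum_congr rfl fun x _ => ?_
    field_simp
    ring
  have e2 : mean Q (fun z => ∑ x, 2 * p x / n * (count z x : ℝ)) = 2 * ∑ x, p x ^ 2 := by
    rw [mean_sum, Finset.mul_sum]
    refine Finset.sum_congr rfl fun x _ => ?_
    rw [mean_const_mul, hmean]
    field_simp
  rw [e, mean_add, mean_sub, mean_const_mul, e2, mean_const h.sum_one]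
  have h3 : 1 / (n : ℝ) ^ 2 * mean Q (fun z => ∑ x, (count z x : ℝ) ^ 2) ≤
      ∑ x, p x ^ 2 + κ + 2 * τ / n := by
    refine (mul_le_mul_of_nonneg_left hsq (by positivity)).trans (le_of_eq ?_)
    field_simp
  linarith

/-! ### Frequent symbols -/

/-- The error of the empirical frequencies on the symbols seen at least `m` times.  A symbol with
mass at least `m / (2 * n)` (there are at most `2 * n / m` of these) is treated by the
arithmetic-geometric mean inequality with weight `a`; any other one deviates by `m / (2 * n)` or
more. -/
lemma mean_frequent_le (h : IsMixingLaw Q p τ κ) (hn : 1 ≤ n) {m : ℕ} (hm : 1 ≤ m) {a : ℝ}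
    (ha : n / m ≤ a) :
    mean Q (fun z => ∑ x, if m ≤ count z x then |p x - count z x / n| else 0) ≤
      2 * a * (2 * τ / n + κ) + n / (m * a) := by
  have hn0 : (0 : ℝ) < n := by exact_mod_cast hn
  have hm0 : (0 : ℝ) < m := by exact_mod_cast hm
  have ha0 : 0 < a := lt_of_lt_of_le (by positivity) ha
  have pt : ∀ z : Fin n → S, ∀ x,
      (if m ≤ count z x then |p x - count z x / n| else 0) ≤
        2 * a * (count z x / n - p x) ^ 2 + n / (m * a) * p x := by
    intro z x
    have hp := h.mass_nonneg hn x
    split_ifs with hc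
    swap
    · positivity
    rw [abs_sub_comm]
    set d := (count z x : ℝ) / n - p x with hd
    rw [← sq_abs d]
    by_cases hx : m / (2 * n) ≤ p x
    · have h1 : 1 / (2 * a) ≤ n / (m * a) * p x := by
        calc 1 / (2 * a) = n / (m * a) * (m / (2 * n)) := by field_simp
          _ ≤ _ := mul_le_mul_of_nonneg_left hx (by positivity)
      have h2 : |d| ≤ a / 2 * |d| ^ 2 + 1 / (2 * a) := by
        have h3 : a / 2 * |d| ^ 2 + 1 / (2 * a) - |d| = (a * |d| - 1) ^ 2 / (2 * a) := by
          field_simp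
          ring
        have h4 : 0 ≤ (a * |d| - 1) ^ 2 / (2 * a) := by positivity
        linarith
      have h5 : 0 ≤ a * |d| ^ 2 := by positivity
      linarith
    · have h1 : (m : ℝ) / n ≤ count z x / n := by
        have : (m : ℝ) ≤ count z x := by exact_mod_cast hc
        gcongr
      have h2 : m / (2 * n) ≤ |d| := by
        refine le_trans ?_ (le_abs_self d)
        have : (m : ℝ) / n = m / (2 * n) + m / (2 * n) := by
          field_simp
          norm_num
        rw [hd]
        linarith
      have h3 : 1 ≤ 2 * a * |d| := by
        calc (1 : ℝ) = 2 * (n / m) * (m / (2 * n)) := by field_simp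
          _ ≤ 2 * a * |d| := by gcongr
      have h4 : |d| ≤ 2 * a * |d| * |d| := le_mul_of_one_le_left (abs_nonneg _) h3
      have h5 : 0 ≤ n / (m * a) * p x := by positivity
      nlinarith
  calc mean Q (fun z => ∑ x, if m ≤ count z x then |p x - count z x / n| else 0)
      ≤ mean Q (fun z => 2 * a * (∑ x, (count z x / n - p x) ^ 2) + n / (m * a)) := by
        refine mean_mono h.nonneg fun z => ?_
        refine (Finset.sum_le_sum fun x _ => pt z x).trans (le_of_eq ?_)
        rw [Finset.sum_add_distrib, ← Finset.mul_sum, ← Finset.mul_sum, h.mass_sum_one hn, mul_one]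
    _ = 2 * a * mean Q (fun z => ∑ x, (count z x / n - p x) ^ 2) + n / (m * a) := by
        rw [mean_add, mean_const_mul, mean_const h.sum_one]
    _ ≤ _ := by
        have := h.mean_sum_sq_deviation_le hn
        gcongr

/-- Symbols of mass at least `6 * m / n` are rarely seen fewer than `3 * m` times. -/
lemma mean_heavy_le (h : IsMixingLaw Q p τ κ) (hn : 1 ≤ n) {m : ℕ} (hm : 1 ≤ m) :
    mean Q (fun z => ∑ x, if 6 * m / n ≤ p x ∧ count z x < 3 * m then p x else 0) ≤
      2 * n / (3 * m) * (2 * τ / n + κ) := by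
  have hn0 : (0 : ℝ) < n := by exact_mod_cast hn
  have hm0 : (0 : ℝ) < m := by exact_mod_cast hm
  have pt : ∀ z : Fin n → S, ∀ x, (if 6 * m / n ≤ p x ∧ count z x < 3 * m then p x else 0) ≤
      2 * n / (3 * m) * (count z x / n - p x) ^ 2 := by
    intro z x
    split_ifs with hc
    swap
    · positivity
    obtain ⟨h1, h2⟩ := hc
    have h3 : (count z x : ℝ) / n ≤ 3 * m / n := by
      have : (count z x : ℝ) ≤ 3 * m := by exact_mod_cast h2.le
      gcongr
    have h4 : 6 * (m : ℝ) / n = 2 * (3 * m / n) := by ring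
    set d := p x - (count z x : ℝ) / n with hd
    have h5 : 3 * m / n ≤ d := by rw [hd]; linarith
    have h6 : p x ≤ 2 * d := by rw [hd]; linarith
    have h7 : 0 ≤ d := le_trans (by positivity) h5
    calc p x ≤ 2 * d := h6
      _ = 2 * n / (3 * m) * (d * (3 * m / n)) := by field_simp
      _ ≤ 2 * n / (3 * m) * (d * d) := by gcongr
      _ = _ := by rw [hd]; ring
  calc mean Q (fun z => ∑ x, if 6 * m / n ≤ p x ∧ count z x < 3 * m then p x else 0)
      ≤ mean Q (fun z => 2 * n / (3 * m) * (∑ x, (count z x / n - p x) ^ 2)) := by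
        refine mean_mono h.nonneg fun z => ?_
        rw [Finset.mul_sum]
        exact Finset.sum_le_sum fun x _ => pt z x
    _ = 2 * n / (3 * m) * mean Q (fun z => ∑ x, (count z x / n - p x) ^ 2) := by
        rw [mean_const_mul]
    _ ≤ _ := by
        have := h.mean_sum_sq_deviation_le hn
        gcongr

end IsMixingLaw

/-! ### Local errors of the leave-a-window-out estimator -/

lemma boole_nonneg (P : Prop) [Decidable P] : (0 : ℝ) ≤ if P then 1 else 0 := by
  split_ifs <;> norm_num

lemma boole_le_one (P : Prop) [Decidable P] : (if P then (1 : ℝ) else 0) ≤ 1 := by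
  split_ifs <;> norm_num

lemma sum_mass_mul_le {S : Type*} [Fintype S] {p : S → ℝ} (hp : ∀ x, 0 ≤ p x)
    (hp1 : ∑ x, p x = 1) (L : Finset S) {f : S → ℝ} {B : ℝ} (h0 : 0 ≤ B) (h1 : ∀ x, f x ≤ B) :
    ∑ x ∈ L, p x * f x ≤ B := by
  calc ∑ x ∈ L, p x * f x ≤ ∑ x ∈ L, p x * B :=
        Finset.sum_le_sum fun x _ => mul_le_mul_of_nonneg_left (h1 x) (hp x)
    _ ≤ ∑ x, p x * B :=
        Finset.sum_le_univ_sum_of_nonneg fun x => mul_nonneg (hp x) h0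
    _ = B := by rw [← Finset.sum_mul, hp1, one_mul]

section LocalError

variable {n : ℕ} {S : Type*} [DecidableEq S]

/-- The contribution of the index `i` and of the symbols in `L` to the error of a
leave-a-window-out estimator at the count `ζ`, where the symbol at `i` is counted on the indices
`I` and the target mass is computed from the counts on `J`. -/
def localError (p : S → ℝ) (L : Finset S) (i : Fin n) (I J : Finset (Fin n)) (ζ : ℕ)
    (z : Fin n → S) : ℝ :=
  ∑ x ∈ L, ((if z i = x then (1 : ℝ) else 0) * (if countOn z I x = ζ then 1 else 0) -
    p x * (if countOn z J x = ζ then 1 else 0))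

/-- The indicator of `z i = x`, centred at its mean `p x` and restricted to the symbols in `L`. -/
def centredHit (p : S → ℝ) (L : Finset S) (i : Fin n) (x : S) (z : Fin n → S) : ℝ :=
  if x ∈ L then (if z i = x then (1 : ℝ) else 0) - p x else 0

lemma dependsOn_countOn {I : Finset (Fin n)} {s : Set (Fin n)} (h : ∀ k ∈ I, k ∈ s) (x : S) :
    DependsOn (fun z => countOn z I x) s := by
  intro z z' hz
  have : ∀ k ∈ I, (z k = x ↔ z' k = x) := fun k hk => by rw [hz k (h k hk)]
  simp only [countOn, Finset.filter_congr this]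

lemma dependsOn_centredHit {s : Set (Fin n)} (p : S → ℝ) (L : Finset S) {i : Fin n} (h : i ∈ s)
    (x : S) : DependsOn (centredHit p L i x) s := by
  intro z z' hz
  simp only [centredHit, hz i h]

lemma countOn_add_countOn_sdiff (z : Fin n → S) {I J : Finset (Fin n)} (h : J ⊆ I) (x : S) :
    countOn z J x + countOn z (I \ J) x = countOn z I x := by
  unfold countOn
  rw [add_comm, ← Finset.card_union_of_disjoint
    (Finset.disjoint_filter_filter Finset.sdiff_disjoint), ← Finset.filter_union,
    Finset.sdiff_union_of_subset h]

lemma sum_range_ite_eq_le (a m : ℕ) : ∑ ζ ∈ Finset.range m, (if a = ζ then (1 : ℝ) else 0) ≤ 1 := by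
  rw [Finset.sum_ite_eq]
  split_ifs <;> norm_num

lemma sum_range_abs_ite_sub_le (a d m : ℕ) :
    ∑ ζ ∈ Finset.range m, |(if a + d = ζ then (1 : ℝ) else 0) - (if a = ζ then 1 else 0)| ≤
      2 * d := by
  rcases Nat.eq_zero_or_pos d with rfl | hd
  · simp
  have h1 : (1 : ℝ) ≤ d := by exact_mod_cast hd
  calc ∑ ζ ∈ Finset.range m, |(if a + d = ζ then (1 : ℝ) else 0) - (if a = ζ then 1 else 0)|
      ≤ ∑ ζ ∈ Finset.range m, ((if a + d = ζ then (1 : ℝ) else 0) + (if a = ζ then 1 else 0)) := by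
        refine Finset.sum_le_sum fun ζ _ => ?_
        split_ifs <;> norm_num
    _ ≤ 2 * d := by
        rw [Finset.sum_add_distrib]
        have := sum_range_ite_eq_le (a + d) m
        have := sum_range_ite_eq_le a m
        linarith

lemma sum_ite_eq_mul_le {L : Finset S} (z : Fin n → S) (i : Fin n) {f : S → ℝ} {B : ℝ}
    (h0 : 0 ≤ B) (h1 : ∀ x, f x ≤ B) :
    ∑ x ∈ L, (if z i = x then (1 : ℝ) else 0) * f x ≤ B := by
  simp only [ite_mul, one_mul, zero_mul, Finset.sum_ite_eq]
  split_ifs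
  · exact h1 _
  · exact h0

/-- Shrinking the index sets on which symbols are counted changes the local errors by at most the
number of dropped occurrences. -/
lemma sum_abs_localError_sub_le {p : S → ℝ} (hp : ∀ x, 0 ≤ p x) (L : Finset S) (i : Fin n)
    {I I' J J' : Finset (Fin n)} (hI : I' ⊆ I) (hJ : J' ⊆ J) (m : ℕ) (z : Fin n → S) :
    ∑ ζ ∈ Finset.range m, |localError p L i I J ζ z - localError p L i I' J' ζ z| ≤
      2 * (∑ k ∈ I \ I', ∑ x ∈ L, (if z i = x then (1 : ℝ) else 0) * (if z k = x then 1 else 0)) +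
      2 * ∑ k ∈ J \ J', ∑ x ∈ L, p x * (if z k = x then 1 else 0) := by
  have hd : ∀ {A A' : Finset (Fin n)}, A' ⊆ A → ∀ x,
      ∑ ζ ∈ Finset.range m, |(if countOn z A x = ζ then (1 : ℝ) else 0) -
        (if countOn z A' x = ζ then 1 else 0)| ≤ 2 * ∑ k ∈ A \ A', if z k = x then 1 else 0 := by
    intro A A' h x
    rw [← countOn_add_countOn_sdiff z h x, ← countOn_eq_sum]
    exact sum_range_abs_ite_sub_le _ _ m
  calc ∑ ζ ∈ Finset.range m, |localError p L i I J ζ z - localError p L i I' J' ζ z|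
      ≤ ∑ ζ ∈ Finset.range m, ∑ x ∈ L, ((if z i = x then (1 : ℝ) else 0) *
          |(if countOn z I x = ζ then (1 : ℝ) else 0) - (if countOn z I' x = ζ then 1 else 0)| +
          p x * |(if countOn z J x = ζ then (1 : ℝ) else 0) -
            (if countOn z J' x = ζ then 1 else 0)|) := by
        refine Finset.sum_le_sum fun ζ _ => ?_
        rw [localError, localError, ← Finset.sum_sub_distrib]
        refine (Finset.abs_sum_le_sum_abs _ _).trans (Finset.sum_le_sum fun x _ => ?_)
        rw [← abs_of_nonneg (boole_nonneg (z i = x)), ← abs_of_nonneg (hp x), ← abs_mul,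
          ← abs_mul, abs_of_nonneg (boole_nonneg (z i = x)), abs_of_nonneg (hp x)]
        refine le_trans (le_of_eq ?_) (abs_sub _ _)
        congr 1
        ring
    _ = ∑ x ∈ L, ((if z i = x then (1 : ℝ) else 0) *
          (∑ ζ ∈ Finset.range m, |(if countOn z I x = ζ then (1 : ℝ) else 0) -
            (if countOn z I' x = ζ then 1 else 0)|) +
          p x * ∑ ζ ∈ Finset.range m, |(if countOn z J x = ζ then (1 : ℝ) else 0) -
            (if countOn z J' x = ζ then 1 else 0)|) := by
        rw [Finset.sum_comm]
        refine Finset.sum_congr rfl fun x _ => ?_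
        rw [Finset.sum_add_distrib, Finset.mul_sum, Finset.mul_sum]
    _ ≤ ∑ x ∈ L, ((if z i = x then (1 : ℝ) else 0) *
          (2 * ∑ k ∈ I \ I', if z k = x then 1 else 0) +
          p x * (2 * ∑ k ∈ J \ J', if z k = x then 1 else 0)) := by
        refine Finset.sum_le_sum fun x _ => add_le_add ?_ ?_
        · exact mul_le_mul_of_nonneg_left (hd hI x) (boole_nonneg _)
        · exact mul_le_mul_of_nonneg_left (hd hJ x) (hp x)
    _ = _ := by
        rw [Finset.sum_comm (s := I \ I'), Finset.sum_comm (s := J \ J'), Finset.mul_sum,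
          Finset.mul_sum, ← Finset.sum_add_distrib]
        refine Finset.sum_congr rfl fun x _ => ?_
        rw [Finset.mul_sum, Finset.mul_sum, Finset.mul_sum, Finset.mul_sum, Finset.mul_sum,
          Finset.mul_sum]
        congr 1 <;> exact Finset.sum_congr rfl fun k _ => by ring

variable [Fintype S] {p : S → ℝ}

lemma abs_localError_le_one (hp : ∀ x, 0 ≤ p x) (hp1 : ∑ x, p x = 1) (L : Finset S) (i : Fin n)
    (I J : Finset (Fin n)) (ζ : ℕ) (z : Fin n → S) : |localError p L i I J ζ z| ≤ 1 := by
  rw [localError, Finset.sum_sub_distrib]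
  have h1 := sum_ite_eq_mul_le (L := L) z i (f := fun x => if countOn z I x = ζ then (1 : ℝ) else 0)
    zero_le_one fun x => boole_le_one _
  have h2 := sum_mass_mul_le hp hp1 L (f := fun x => if countOn z J x = ζ then (1 : ℝ) else 0)
    zero_le_one fun x => boole_le_one _
  have h3 : 0 ≤ ∑ x ∈ L, (if z i = x then (1 : ℝ) else 0) * (if countOn z I x = ζ then 1 else 0) :=
    Finset.sum_nonneg fun x _ => mul_nonneg (boole_nonneg _) (boole_nonneg _)
  have h4 : 0 ≤ ∑ x ∈ L, p x * (if countOn z J x = ζ then 1 else 0) :=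
    Finset.sum_nonneg fun x _ => mul_nonneg (hp x) (boole_nonneg _)
  exact abs_le.2 ⟨by linarith, by linarith⟩

lemma sum_abs_localError_le (hp : ∀ x, 0 ≤ p x) (hp1 : ∑ x, p x = 1) (L : Finset S) (i : Fin n)
    (I J : Finset (Fin n)) (m : ℕ) (z : Fin n → S) :
    ∑ ζ ∈ Finset.range m, |localError p L i I J ζ z| ≤ 2 := by
  calc ∑ ζ ∈ Finset.range m, |localError p L i I J ζ z|
      ≤ ∑ ζ ∈ Finset.range m, (∑ x ∈ L, (if z i = x then (1 : ℝ) else 0) *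
          (if countOn z I x = ζ then 1 else 0) +
          ∑ x ∈ L, p x * (if countOn z J x = ζ then 1 else 0)) := by
        refine Finset.sum_le_sum fun ζ _ => ?_
        rw [localError, Finset.sum_sub_distrib]
        have h3 : 0 ≤ ∑ x ∈ L, (if z i = x then (1 : ℝ) else 0) *
            (if countOn z I x = ζ then 1 else 0) :=
          Finset.sum_nonneg fun x _ => mul_nonneg (boole_nonneg _) (boole_nonneg _)
        have h4 : 0 ≤ ∑ x ∈ L, p x * (if countOn z J x = ζ then 1 else 0) :=
          Finset.sum_nonneg fun x _ => mul_nonneg (hp x) (boole_nonneg _)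
        exact abs_le.2 ⟨by linarith, by linarith⟩
    _ = ∑ x ∈ L, (if z i = x then (1 : ℝ) else 0) *
          (∑ ζ ∈ Finset.range m, if countOn z I x = ζ then 1 else 0) +
        ∑ x ∈ L, p x * (∑ ζ ∈ Finset.range m, if countOn z J x = ζ then 1 else 0) := by
        rw [Finset.sum_add_distrib, Finset.sum_comm, Finset.sum_comm (s := Finset.range m)]
        simp_rw [Finset.mul_sum]
    _ ≤ 2 := by
        have h1 := sum_ite_eq_mul_le (L := L) z i zero_le_one
          fun x => sum_range_ite_eq_le (countOn z I x) m
        have h2 := sum_mass_mul_le hp hp1 L zero_le_one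
          fun x => sum_range_ite_eq_le (countOn z J x) m
        linarith

lemma sum_abs_centredHit_le (hp : ∀ x, 0 ≤ p x) (hp1 : ∑ x, p x = 1) (L : Finset S) (i : Fin n)
    (z : Fin n → S) : ∑ x, |centredHit p L i x z| ≤ 2 := by
  calc ∑ x, |centredHit p L i x z| ≤ ∑ x, ((if z i = x then (1 : ℝ) else 0) + p x) := by
        refine Finset.sum_le_sum fun x _ => ?_
        have := hp x
        unfold centredHit
        split_ifs
        · exact abs_le.2 ⟨by linarith, by linarith⟩
        · exact abs_le.2 ⟨by linarith, by linarith⟩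
        · simp only [abs_zero]
          linarith
        · simp only [abs_zero]
          linarith
    _ = 2 := by
        rw [Finset.sum_add_distrib, hp1]
        simp
        norm_num

lemma localError_self (L : Finset S) (i : Fin n) (I : Finset (Fin n)) (ζ : ℕ) (z : Fin n → S) :
    localError p L i I I ζ z =
      ∑ x, centredHit p L i x z * (if countOn z I x = ζ then 1 else 0) := by
  simp only [localError, centredHit, ite_mul, zero_mul, Finset.sum_ite_mem, Finset.univ_inter,
    sub_mul]

/-- For a count split between the two sequences, the projective norm grows by the number `ζ + 1` of
ways of splitting the total `ζ`. -/
lemma projBound_sum_count_add {s t : Set (Fin n)} {a c : S → (Fin n → S) → ℕ}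
    {q : S → (Fin n → S) → ℝ} {B : ℝ} (ha : ∀ x, DependsOn (a x) s) (hc : ∀ x, DependsOn (c x) t)
    (hq : ∀ x, DependsOn (q x) t) (hn : ∀ z, ∑ x, a x z ≤ n) (hB : ∀ z, ∑ x, |q x z| ≤ B)
    (ζ : ℕ) :
    ProjBound s t (fun z z' => ∑ x, q x z' * (if a x z + c x z' = ζ then 1 else 0))
      ((ζ + 1) * ((n + 1) * B)) := by
  have h1 := ProjBound.sum (Finset.range (ζ + 1)) (s := s) (t := t) (c := (n + 1) * B)
    (F := fun r z z' => ∑ x, (if a x z = r then (1 : ℝ) else 0) *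
      (q x z' * (if r + c x z' = ζ then 1 else 0))) (by
    intro r _
    refine projBound_sum_count (g := fun _ k => if k = r then (1 : ℝ) else 0)
      (v := fun x z' => q x z' * (if r + c x z' = ζ then (1 : ℝ) else 0)) ha ?_ hn ?_ ?_ ?_
    · intro x z z' hz
      simp only [hq x hz, hc x hz]
    · intro x k
      split_ifs <;> norm_num
    · intro x k
      split_ifs <;> norm_num
    · intro z
      refine (Finset.sum_le_sum fun x _ => ?_).trans (hB z)
      split_ifs <;> simp)
  have e : (fun z z' => ∑ x, q x z' * (if a x z + c x z' = ζ then (1 : ℝ) else 0)) =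
      fun z z' => ∑ r ∈ Finset.range (ζ + 1), ∑ x, (if a x z = r then (1 : ℝ) else 0) *
        (q x z' * (if r + c x z' = ζ then 1 else 0)) := by
    funext z z'
    rw [Finset.sum_comm]
    refine Finset.sum_congr rfl fun x _ => ?_
    simp only [ite_mul, one_mul, zero_mul, Finset.sum_ite_eq, Finset.mem_range]
    split_ifs with h1 h2 h2
    · rfl
    · omega
    · simp
    · simp
  rw [e]
  rw [Finset.card_range] at h1
  exact_mod_cast h1

end LocalError

lemma mean_comm {Z : Type*} [Fintype Z] {Q : Z → ℝ} (F : Z → Z → ℝ) :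
    mean Q (fun z => mean Q (fun z' => F z z')) = mean Q (fun z' => mean Q (fun z => F z z')) := by
  simp only [mean, Finset.mul_sum]
  rw [Finset.sum_comm]
  exact Finset.sum_congr rfl fun z _ => Finset.sum_congr rfl fun z' _ => by ring

namespace IsMixingLaw

variable {n : ℕ} {S : Type*} [Fintype S] [DecidableEq S]
  {Q : (Fin n → S) → ℝ} {p : S → ℝ} {τ : ℕ} {κ : ℝ}

lemma mean_centredHit (h : IsMixingLaw Q p τ κ) (L : Finset S) (i : Fin n) (x : S) :
    mean Q (centredHit p L i x) = 0 := by
  unfold centredHit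
  split_ifs
  · rw [mean_sub, h.marginal, mean_const h.sum_one, sub_self]
  · exact mean_const h.sum_one 0

/-- Local errors at distant indices `i` and `j` are nearly uncorrelated once both windows are left
out of all counts: after freezing the counts on the indices before the window of `i`, and then
decoupling `z i` from everything after that window, the error at `i` has mean zero. -/
lemma abs_mean_localError_mul_le (h : IsMixingLaw Q p τ κ) (L : Finset S) {i j : Fin n}
    (hij : (i : ℕ) + τ ≤ j) (ζ : ℕ) :
    |mean Q (fun z =>
      localError p L i (indepSet τ i ∩ indepSet τ j) (indepSet τ i ∩ indepSet τ j) ζ z *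
      localError p L j (indepSet τ i ∩ indepSet τ j) (indepSet τ i ∩ indepSet τ j) ζ z)| ≤
      κ * (((ζ + 1) * ((n + 1) * 2)) * ((ζ + 1) * ((n + 1) * 2))) +
      κ * (((n + 1) * 2) * (1 * 2)) := by
  have hn : 1 ≤ n := i.pos
  have hp := h.mass_nonneg hn
  have hp1 := h.mass_sum_one hn
  set I := indepSet τ i ∩ indepSet τ j with hI
  let G : Finset (Fin n) := Finset.univ.filter fun k => (k : ℕ) + τ ≤ i
  have hGI : G ⊆ I := by
    intro k hk
    have hk' : (k : ℕ) + τ ≤ i := (Finset.mem_filter.1 hk).2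
    rw [hI, Finset.mem_inter, mem_indepSet, mem_indepSet]
    omega
  have hH : ∀ k ∈ I \ G, (i : ℕ) + τ ≤ k := by
    intro k hk
    rw [Finset.mem_sdiff, hI, Finset.mem_inter, mem_indepSet] at hk
    have : ¬ ((k : ℕ) + τ ≤ i) := fun h' => hk.2 (Finset.mem_filter.2 ⟨Finset.mem_univ _, h'⟩)
    omega
  -- the local error at `l`, with the counts before the window of `i` taken from `z`
  let Φ (l : Fin n) (z z' : Fin n → S) : ℝ := ∑ x, centredHit p L l x z' *
    (if countOn z G x + countOn z' (I \ G) x = ζ then 1 else 0)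
  have hΦ : ∀ l z, localError p L l I I ζ z = Φ l z z := by
    intro l z
    rw [localError_self]
    simp only [Φ, countOn_add_countOn_sdiff z hGI]
  have hΦ2 : ∀ l z z', |Φ l z z'| ≤ 2 := by
    intro l z z'
    refine (Finset.abs_sum_le_sum_abs _ _).trans
      ((Finset.sum_le_sum fun x _ => ?_).trans (sum_abs_centredHit_le hp hp1 L l z'))
    split_ifs <;> simp
  have hsum : ∀ (A : Finset (Fin n)) (z : Fin n → S), ∑ x, countOn z A x ≤ n := by
    intro A z
    rw [sum_countOn]
    exact (Finset.card_le_univ A).trans_eq (Fintype.card_fin n)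
  have hbound : ∀ l : Fin n, (i : ℕ) ≤ l →
      ProjBound {k : Fin n | (k : ℕ) + τ ≤ i} {k : Fin n | (i : ℕ) ≤ k} (Φ l)
        ((ζ + 1) * ((n + 1) * 2)) := by
    intro l hl
    refine projBound_sum_count_add (a := fun x z => countOn z G x)
      (c := fun x z => countOn z (I \ G) x) (q := fun x z => centredHit p L l x z) ?_ ?_ ?_
      (hsum G) (sum_abs_centredHit_le hp hp1 L l) ζ
    · exact dependsOn_countOn fun k hk => (Finset.mem_filter.1 hk).2
    · exact dependsOn_countOn fun k hk => le_trans (Nat.le_add_right _ _) (hH k hk)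
    · exact dependsOn_centredHit p L hl
  have step1 := h.decouple ((hbound i le_rfl).mul (hbound j (by omega)))
  -- for a frozen first sequence, decouple `z i` from the indices after its window
  have step2 : ∀ z₀ : Fin n → S, |mean Q (fun z => Φ i z₀ z * Φ j z₀ z)| ≤
      κ * (((n + 1) * 2) * (1 * 2)) := by
    intro z₀
    let Ψ (z z' : Fin n → S) : ℝ := ∑ x,
      (if countOn z₀ G x + countOn z' (I \ G) x = ζ then 1 else 0) * centredHit p L i x z
    have hΨ : ProjBound {k : Fin n | (k : ℕ) + τ ≤ i + τ} {k : Fin n | (i : ℕ) + τ ≤ k} Ψ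
        ((n + 1) * 2) := by
      have := projBound_sum_count (s := {k : Fin n | (i : ℕ) + τ ≤ k})
        (t := {k : Fin n | (k : ℕ) + τ ≤ i + τ}) (a := fun x z => countOn z (I \ G) x)
        (g := fun x k => if countOn z₀ G x + k = ζ then (1 : ℝ) else 0)
        (v := fun x z => centredHit p L i x z) (B := 2)
        (dependsOn_countOn hH) (dependsOn_centredHit p L (by simp)) (hsum _)
        (fun x k => by split_ifs <;> norm_num)
        (fun x k => by split_ifs <;> norm_num) (sum_abs_centredHit_le hp hp1 L i)
      exact this.swap
    have hΦj : ProjBound {k : Fin n | (k : ℕ) + τ ≤ i + τ} {k : Fin n | (i : ℕ) + τ ≤ k}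
        (fun _ z' => 1 * Φ j z₀ z') (1 * 2) := by
      refine projBound_tensor (u := fun _ => 1) (v := Φ j z₀) (fun _ _ _ => rfl) ?_ (by simp)
        (hΦ2 j z₀)
      intro z z' hz
      refine Finset.sum_congr rfl fun x _ => ?_
      have e1 := dependsOn_countOn hH x hz
      have e2 := dependsOn_centredHit p L
        (show j ∈ {k : Fin n | (i : ℕ) + τ ≤ k} from hij) x hz
      simp only at e1
      rw [e1, e2]
    have h3 := h.decouple (hΨ.mul hΦj)
    have h4 : mean Q (fun z => mean Q fun z' => Ψ z z' * (1 * Φ j z₀ z')) = 0 := by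
      rw [mean_comm]
      have : ∀ z', mean Q (fun z => Ψ z z' * (1 * Φ j z₀ z')) = 0 := by
        intro z'
        rw [mean_mul_const, mean_sum]
        simp_rw [mean_const_mul]
        have e : ∀ x, mean Q (fun z => centredHit p L i x z) = 0 := h.mean_centredHit L i
        simp [e]
      simp_rw [this]
      exact mean_const h.sum_one 0
    rw [h4, sub_zero] at h3
    have e : (fun z => Φ i z₀ z * Φ j z₀ z) = fun z => Ψ z z * (1 * Φ j z₀ z) := by
      funext z
      rw [one_mul]
      congr 1
      exact Finset.sum_congr rfl fun x _ => mul_comm _ _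
    rw [e]
    exact h3
  have step3 := abs_mean_le h.nonneg h.sum_one step2
  simp_rw [hΦ]
  have h5 := abs_add_le (mean Q (fun z => Φ i z z * Φ j z z) -
    mean Q (fun z => mean Q fun z' => Φ i z z' * Φ j z z'))
    (mean Q (fun z => mean Q fun z' => Φ i z z' * Φ j z z'))
  rw [sub_add_cancel] at h5
  exact h5.trans (add_le_add step1 step3)

/-- Leaving out a second window has a small effect on the local errors at light symbols, because two
given indices rarely carry the same light symbol. -/
lemma mean_localError_sub_le (h : IsMixingLaw Q p τ κ) {L : Finset S} {δ : ℝ} (hδ : 0 ≤ δ)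
    (hL : ∀ x ∈ L, p x ≤ δ) (i j : Fin n) (m : ℕ) :
    mean Q (fun z => ∑ ζ ∈ Finset.range m,
      |localError p L i (indepSet τ i) Finset.univ ζ z -
        localError p L i (indepSet τ i ∩ indepSet τ j) (indepSet τ i ∩ indepSet τ j) ζ z|) ≤
      12 * τ * (δ + κ) := by
  have hn : 1 ≤ n := i.pos
  have hp := h.mass_nonneg hn
  have hp1 := h.mass_sum_one hn
  have hκ := h.kappa_nonneg
  have hsq : ∑ x ∈ L, p x ^ 2 ≤ δ := by
    calc ∑ x ∈ L, p x ^ 2 ≤ ∑ x ∈ L, p x * δ := Finset.sum_le_sum fun x hx => by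
          rw [sq]
          exact mul_le_mul_of_nonneg_left (hL x hx) (hp x)
      _ ≤ ∑ x, p x * δ := Finset.sum_le_univ_sum_of_nonneg fun x => mul_nonneg (hp x) hδ
      _ = δ := by rw [← Finset.sum_mul, hp1, one_mul]
  set I := indepSet τ i ∩ indepSet τ j with hI
  have c1 : ((indepSet τ i \ I).card : ℝ) ≤ 2 * τ := by
    have : indepSet τ i \ I ⊆ depSet τ j := by
      intro k hk
      rw [Finset.mem_sdiff, hI, Finset.mem_inter, mem_indepSet, mem_indepSet] at hk
      rw [mem_depSet]
      omega
    exact_mod_cast (Finset.card_le_card this).trans (card_depSet_le τ j)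
  have c2 : ((Finset.univ \ I).card : ℝ) ≤ 4 * τ := by
    have : Finset.univ \ I ⊆ depSet τ i ∪ depSet τ j := by
      intro k hk
      rw [Finset.mem_sdiff, hI, Finset.mem_inter, mem_indepSet, mem_indepSet] at hk
      rw [Finset.mem_union, mem_depSet, mem_depSet]
      omega
    have h1 := (Finset.card_le_card this).trans (Finset.card_union_le _ _)
    have h2 := card_depSet_le τ i
    have h3 := card_depSet_le τ j
    have : (Finset.univ \ I).card ≤ 4 * τ := by omega
    exact_mod_cast this
  have t1 : mean Q (fun z => ∑ k ∈ indepSet τ i \ I, ∑ x ∈ L,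
      (if z i = x then (1 : ℝ) else 0) * (if z k = x then 1 else 0)) ≤ 2 * τ * (δ + κ) := by
    rw [mean_sum]
    calc _ ≤ ∑ k ∈ indepSet τ i \ I, (δ + κ) := by
          refine Finset.sum_le_sum fun k hk => ?_
          have := (abs_le.1 (h.abs_coincidence_sub_le L (Finset.mem_sdiff.1 hk).1)).2
          linarith
      _ ≤ _ := by
          rw [Finset.sum_const, nsmul_eq_mul]
          gcongr
  have t2 : mean Q (fun z => ∑ k ∈ Finset.univ \ I, ∑ x ∈ L,
      p x * (if z k = x then (1 : ℝ) else 0)) ≤ 4 * τ * δ := by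
    rw [mean_sum]
    calc _ ≤ ∑ k ∈ Finset.univ \ I, δ := by
          refine Finset.sum_le_sum fun k _ => ?_
          rw [mean_sum]
          refine le_trans (le_of_eq ?_) hsq
          refine Finset.sum_congr rfl fun x _ => ?_
          rw [mean_const_mul, h.marginal, sq]
      _ ≤ _ := by
          rw [Finset.sum_const, nsmul_eq_mul]
          gcongr
  have h1 := mean_mono h.nonneg fun z => sum_abs_localError_sub_le hp L i
    (Finset.inter_subset_left : I ⊆ indepSet τ i) (Finset.subset_univ I) m z
  rw [mean_add, mean_const_mul, mean_const_mul] at h1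
  have : 0 ≤ τ * κ := by positivity
  nlinarith

lemma sum_mean_localError_mul_le (h : IsMixingLaw Q p τ κ) {L : Finset S} {δ : ℝ} (hδ : 0 ≤ δ)
    (hL : ∀ x ∈ L, p x ≤ δ) {i j : Fin n} (hij : j ∈ indepSet τ i) (m : ℕ) :
    ∑ ζ ∈ Finset.range m, mean Q (fun z => localError p L i (indepSet τ i) Finset.univ ζ z *
      localError p L j (indepSet τ j) Finset.univ ζ z) ≤
      24 * (κ * m ^ 3 * n ^ 2) + 24 * τ * (δ + κ) := by
  have main : ∀ i j : Fin n, (i : ℕ) + τ ≤ j →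
      ∑ ζ ∈ Finset.range m, mean Q (fun z => localError p L i (indepSet τ i) Finset.univ ζ z *
        localError p L j (indepSet τ j) Finset.univ ζ z) ≤
        24 * (κ * m ^ 3 * n ^ 2) + 24 * τ * (δ + κ) := by
    intro i j hij
    have hn : 1 ≤ n := i.pos
    have hp := h.mass_nonneg hn
    have hp1 := h.mass_sum_one hn
    have hκ := h.kappa_nonneg
    set I := indepSet τ i ∩ indepSet τ j with hI
    have e1 := h.mean_localError_sub_le hδ hL i j m
    have e2 := h.mean_localError_sub_le hδ hL j i m
    rw [← hI] at e1
    rw [Finset.inter_comm, ← hI] at e2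
    rw [mean_sum] at e1 e2
    have hn1 : (1 : ℝ) ≤ n := by exact_mod_cast hn
    have e3 : ∀ ζ ∈ Finset.range m,
        mean Q (fun z => localError p L i (indepSet τ i) Finset.univ ζ z *
          localError p L j (indepSet τ j) Finset.univ ζ z) ≤
        24 * (κ * m ^ 2 * n ^ 2) +
        mean Q (fun z => |localError p L i (indepSet τ i) Finset.univ ζ z -
          localError p L i I I ζ z|) +
        mean Q (fun z => |localError p L j (indepSet τ j) Finset.univ ζ z -
          localError p L j I I ζ z|) := by
      intro ζ hζ
      have hm : (ζ : ℝ) + 1 ≤ m := by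
        exact_mod_cast Nat.succ_le_of_lt (Finset.mem_range.1 hζ)
      have h1 := (abs_le.1 (h.abs_mean_localError_mul_le L hij ζ)).2
      rw [← hI] at h1
      have h2 : κ * (((ζ + 1) * (((n : ℝ) + 1) * 2)) * ((ζ + 1) * ((n + 1) * 2))) +
          κ * ((((n : ℝ) + 1) * 2) * (1 * 2)) ≤ 24 * (κ * m ^ 2 * n ^ 2) := by
        have h3 : (n : ℝ) + 1 ≤ 2 * n := by linarith
        have hm1 : (1 : ℝ) ≤ m := le_trans (by linarith [Nat.cast_nonneg (α := ℝ) ζ]) hm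
        have h4 : κ * (((ζ + 1) * (((n : ℝ) + 1) * 2)) * ((ζ + 1) * ((n + 1) * 2))) ≤
            κ * ((m * ((2 * n) * 2)) * (m * ((2 * n) * 2))) := by gcongr
        have h5 : κ * ((((n : ℝ) + 1) * 2) * (1 * 2)) ≤ κ * (((2 * n) * 2) * (1 * 2)) := by gcongr
        have h6 : κ * (n : ℝ) ≤ κ * (m ^ 2 * n ^ 2) := by
          refine mul_le_mul_of_nonneg_left ?_ hκ
          calc (n : ℝ) = 1 * n ^ 1 := by ring
            _ ≤ m ^ 2 * n ^ 2 := mul_le_mul (one_le_pow₀ hm1)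
                (pow_le_pow_right₀ hn1 (by norm_num)) (by positivity) (by positivity)
        nlinarith
      have h7 : mean Q (fun z => localError p L i (indepSet τ i) Finset.univ ζ z *
          localError p L j (indepSet τ j) Finset.univ ζ z) ≤
          mean Q (fun z => (localError p L i I I ζ z * localError p L j I I ζ z +
            |localError p L i (indepSet τ i) Finset.univ ζ z - localError p L i I I ζ z|) +
            |localError p L j (indepSet τ j) Finset.univ ζ z - localError p L j I I ζ z|) := by
        refine mean_mono h.nonneg fun z => ?_
        have b1 := abs_localError_le_one hp hp1 L j (indepSet τ j) Finset.univ ζ z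
        have b2 := abs_localError_le_one hp hp1 L i I I ζ z
        set y := localError p L i (indepSet τ i) Finset.univ ζ z
        set y' := localError p L j (indepSet τ j) Finset.univ ζ z
        set w := localError p L i I I ζ z
        set w' := localError p L j I I ζ z
        have c1 : (y - w) * y' ≤ |y - w| := by
          refine (le_abs_self _).trans ?_
          rw [abs_mul]
          exact mul_le_of_le_one_right (abs_nonneg _) b1
        have c2 : w * (y' - w') ≤ |y' - w'| := by
          refine (le_abs_self _).trans ?_
          rw [abs_mul]
          exact mul_le_of_le_one_left (abs_nonneg _) b2
        linarith
      rw [mean_add, mean_add] at h7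
      linarith
    refine (Finset.sum_le_sum e3).trans ?_
    rw [Finset.sum_add_distrib, Finset.sum_add_distrib, Finset.sum_const, Finset.card_range,
      nsmul_eq_mul]
    have : (m : ℝ) * (24 * (κ * m ^ 2 * n ^ 2)) = 24 * (κ * m ^ 3 * n ^ 2) := by ring
    linarith
  rcases mem_indepSet.1 hij with hij | hij
  · exact main i j hij
  · have := main j i hij
    simp_rw [mul_comm (localError p L j _ _ _ _)] at this
    exact this

/-- The second moment of the error of the leave-a-window-out estimator on light symbols. -/
lemma mean_sum_sq_localError_le (h : IsMixingLaw Q p τ κ) {L : Finset S} {δ : ℝ} (hδ : 0 ≤ δ)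
    (hL : ∀ x ∈ L, p x ≤ δ) (hn : 1 ≤ n) (m : ℕ) :
    mean Q (fun z => ∑ ζ ∈ Finset.range m,
      (∑ i, localError p L i (indepSet τ i) Finset.univ ζ z) ^ 2) ≤
      n ^ 2 * (4 * τ / n + 24 * (κ * m ^ 3 * n ^ 2) + 24 * τ * (δ + κ)) := by
  have hp := h.mass_nonneg hn
  have hp1 := h.mass_sum_one hn
  have hκ := h.kappa_nonneg
  have hn0 : (0 : ℝ) < n := by exact_mod_cast hn
  set R := 24 * (κ * m ^ 3 * n ^ 2) + 24 * τ * (δ + κ) with hR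
  have hR0 : 0 ≤ R := by positivity
  let Y (i : Fin n) (ζ : ℕ) (z : Fin n → S) : ℝ := localError p L i (indepSet τ i) Finset.univ ζ z
  have hpair : ∀ i j : Fin n, ∑ ζ ∈ Finset.range m, mean Q (fun z => Y i ζ z * Y j ζ z) ≤
      R + 2 * if j ∈ depSet τ i then 1 else 0 := by
    intro i j
    split_ifs with hj
    · rw [← mean_sum]
      have : mean Q (fun z => ∑ ζ ∈ Finset.range m, Y i ζ z * Y j ζ z) ≤ 2 := by
        refine (mean_mono h.nonneg fun z => ?_).trans_eq (mean_const h.sum_one 2)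
        refine le_trans (Finset.sum_le_sum fun ζ _ => ?_)
          (sum_abs_localError_le hp hp1 L i (indepSet τ i) Finset.univ m z)
        refine (le_abs_self _).trans ?_
        rw [abs_mul]
        exact mul_le_of_le_one_right (abs_nonneg _) (abs_localError_le_one hp hp1 L j _ _ ζ z)
      linarith
    · rw [mul_zero, add_zero]
      exact h.sum_mean_localError_mul_le hδ hL (Finset.mem_compl.2 hj) m
  have e : mean Q (fun z => ∑ ζ ∈ Finset.range m, (∑ i, Y i ζ z) ^ 2) =
      ∑ i, ∑ j, ∑ ζ ∈ Finset.range m, mean Q (fun z => Y i ζ z * Y j ζ z) := by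
    simp_rw [sq, Finset.sum_mul_sum, mean_sum]
    rw [Finset.sum_comm]
    exact Finset.sum_congr rfl fun i _ => Finset.sum_comm
  change mean Q (fun z => ∑ ζ ∈ Finset.range m, (∑ i, Y i ζ z) ^ 2) ≤ _
  rw [e]
  have hi : ∀ i : Fin n, ∑ j, ∑ ζ ∈ Finset.range m, mean Q (fun z => Y i ζ z * Y j ζ z) ≤
      n * R + 4 * τ := by
    intro i
    refine (Finset.sum_le_sum fun j _ => hpair i j).trans ?_
    rw [Finset.sum_add_distrib, ← Finset.mul_sum, Finset.sum_boole, Finset.sum_const,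
      Finset.card_univ, Fintype.card_fin, nsmul_eq_mul]
    have : ((Finset.univ.filter (· ∈ depSet τ i)).card : ℝ) ≤ 2 * τ := by
      rw [Finset.filter_mem_eq_inter, Finset.univ_inter]
      exact_mod_cast card_depSet_le τ i
    linarith
  refine (Finset.sum_le_sum fun i _ => hi i).trans (le_of_eq ?_)
  rw [Finset.sum_const, Finset.card_univ, Fintype.card_fin, nsmul_eq_mul, hR]
  field_simp
  ring

end IsMixingLaw

/-! ### The hybrid estimator -/

section Deterministic

lemma count_le {n : ℕ} {S : Type*} [DecidableEq S] (z : Fin n → S) (x : S) : count z x ≤ n :=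
  (Finset.card_filter_le _ _).trans_eq (Finset.card_fin n)

variable {n : ℕ} {S : Type*} [Fintype S] [DecidableEq S] {p : S → ℝ}

lemma countMass_nonneg (hp : ∀ x, 0 ≤ p x) (z : Fin n → S) (ζ : ℕ) : 0 ≤ countMass p z ζ :=
  Finset.sum_nonneg fun x _ => mul_nonneg (hp x) (by split_ifs <;> norm_num)

lemma sum_countMass (hp1 : ∑ x, p x = 1) (z : Fin n → S) :
    ∑ ζ ∈ Finset.range (n + 1), countMass p z ζ = 1 := by
  unfold countMass
  rw [Finset.sum_comm]
  refine (Finset.sum_congr rfl fun x _ => ?_).trans hp1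
  rw [← Finset.mul_sum, Finset.sum_ite_eq, if_pos, mul_one]
  exact Finset.mem_range.2 (Nat.lt_succ_of_le (count_le z x))

lemma hybridRaw_nonneg (τ ζbar : ℕ) (z : Fin n → S) (ζ : ℕ) : 0 ≤ hybridRaw τ ζbar z ζ := by
  unfold hybridRaw wingIt plugIn
  split_ifs
  · refine mul_nonneg (by positivity) (Finset.sum_nonneg fun i _ => ?_)
    split_ifs <;> norm_num
  · positivity

lemma tvDist_hybrid_le_one (hp : ∀ x, 0 ≤ p x) (hp1 : ∑ x, p x = 1) (τ ζbar : ℕ)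
    (z : Fin n → S) : tvDist n (countMass p z) (hybrid τ ζbar z) ≤ 1 := by
  have hν : 0 ≤ hybridNorm τ ζbar z := Finset.sum_nonneg fun ζ _ => hybridRaw_nonneg τ ζbar z ζ
  have h1 : ∑ ζ ∈ Finset.range (n + 1), |countMass p z ζ - hybrid τ ζbar z ζ| ≤
      ∑ ζ ∈ Finset.range (n + 1), (countMass p z ζ + hybrid τ ζbar z ζ) := by
    refine Finset.sum_le_sum fun ζ _ => ?_
    have := countMass_nonneg hp z ζ
    have : 0 ≤ hybrid τ ζbar z ζ :=
      mul_nonneg (inv_nonneg.2 hν) (hybridRaw_nonneg τ ζbar z ζ)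
    exact abs_le.2 ⟨by linarith, by linarith⟩
  have h2 : ∑ ζ ∈ Finset.range (n + 1), hybrid τ ζbar z ζ ≤ 1 := by
    unfold hybrid
    rw [← Finset.mul_sum]
    change (hybridNorm τ ζbar z)⁻¹ * hybridNorm τ ζbar z ≤ 1
    exact inv_mul_le_one
  rw [Finset.sum_add_distrib, sum_countMass hp1] at h1
  unfold tvDist
  linarith

/-- Normalizing the estimator at most doubles its `ℓ¹` distance to a probability vector. -/
lemma tvDist_hybrid_le (hp : ∀ x, 0 ≤ p x) (hp1 : ∑ x, p x = 1) (τ ζbar : ℕ) (z : Fin n → S) :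
    tvDist n (countMass p z) (hybrid τ ζbar z) ≤
      ∑ ζ ∈ Finset.range (n + 1), |countMass p z ζ - hybridRaw τ ζbar z ζ| := by
  set D := ∑ ζ ∈ Finset.range (n + 1), |countMass p z ζ - hybridRaw τ ζbar z ζ| with hD
  set ν := hybridNorm τ ζbar z with hν
  have hν0 : 0 ≤ ν := Finset.sum_nonneg fun ζ _ => hybridRaw_nonneg τ ζbar z ζ
  have h1 : |1 - ν| ≤ D := by
    rw [← sum_countMass hp1 z, hν, hybridNorm, ← Finset.sum_sub_distrib]
    exact Finset.abs_sum_le_sum_abs _ _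
  rcases hν0.eq_or_lt with h0 | h0
  · -- the unnormalized estimator vanishes, hence it is at distance one from any probability vector
    rw [← h0, sub_zero, abs_one] at h1
    exact (tvDist_hybrid_le_one hp hp1 τ ζbar z).trans h1
  have h2 : ∑ ζ ∈ Finset.range (n + 1), |countMass p z ζ - hybrid τ ζbar z ζ| ≤
      D + |1 - ν⁻¹| * ν := by
    rw [hD, hν, hybridNorm, Finset.mul_sum, ← Finset.sum_add_distrib, ← hybridNorm]
    refine Finset.sum_le_sum fun ζ _ => ?_
    have e : countMass p z ζ - hybrid τ ζbar z ζ =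
        (countMass p z ζ - hybridRaw τ ζbar z ζ) +
          (1 - (hybridNorm τ ζbar z)⁻¹) * hybridRaw τ ζbar z ζ := by
      rw [hybrid]
      ring
    rw [e]
    refine (abs_add_le _ _).trans ?_
    rw [abs_mul, abs_of_nonneg (hybridRaw_nonneg τ ζbar z ζ)]
  have h3 : |1 - ν⁻¹| * ν = |1 - ν| := by
    rw [← abs_of_pos h0, ← abs_mul, abs_of_pos h0, sub_mul, inv_mul_cancel₀ h0.ne', one_mul,
      abs_sub_comm]
  unfold tvDist
  linarith

lemma sum_abs_countMass_sub_hybridRaw_le (τ : ℕ) {m : ℕ} (hm : 1 ≤ m) (z : Fin n → S) :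
    ∑ ζ ∈ Finset.range (n + 1), |countMass p z ζ - hybridRaw τ (m - 1) z ζ| ≤
      ∑ ζ ∈ Finset.range m, |countMass p z ζ - wingIt τ z ζ| +
      ∑ x, if m ≤ count z x then |p x - count z x / n| else 0 := by
  rw [← Finset.sum_filter_add_sum_filter_not (Finset.range (n + 1)) (· < m)]
  refine add_le_add ?_ ?_
  · calc ∑ ζ ∈ (Finset.range (n + 1)).filter (· < m),
          |countMass p z ζ - hybridRaw τ (m - 1) z ζ|
        = ∑ ζ ∈ (Finset.range (n + 1)).filter (· < m), |countMass p z ζ - wingIt τ z ζ| := by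
          refine Finset.sum_congr rfl fun ζ hζ => ?_
          have : ζ ≤ m - 1 := by
            have := (Finset.mem_filter.1 hζ).2
            omega
          rw [hybridRaw, if_pos this]
      _ ≤ _ := by
          refine Finset.sum_le_sum_of_subset_of_nonneg ?_ fun _ _ _ => abs_nonneg _
          exact fun ζ hζ => Finset.mem_range.2 (Finset.mem_filter.1 hζ).2
  · calc ∑ ζ ∈ (Finset.range (n + 1)).filter (¬ · < m),
          |countMass p z ζ - hybridRaw τ (m - 1) z ζ|
        ≤ ∑ ζ ∈ (Finset.range (n + 1)).filter (¬ · < m), ∑ x,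
            if count z x = ζ then |p x - count z x / n| else 0 := by
          refine Finset.sum_le_sum fun ζ hζ => ?_
          have : ¬ ζ ≤ m - 1 := by
            have := (Finset.mem_filter.1 hζ).2
            omega
          rw [hybridRaw, if_neg this, plugIn, numSymbols, countMass, ← Finset.sum_boole,
            Finset.sum_mul, ← Finset.sum_sub_distrib]
          refine (Finset.abs_sum_le_sum_abs _ _).trans (Finset.sum_le_sum fun x _ => ?_)
          split_ifs with h
          · simp [h]
          · simp
      _ ≤ _ := by
          rw [Finset.sum_comm]
          refine Finset.sum_le_sum fun x _ => ?_
          rw [Finset.sum_ite_eq]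
          split_ifs with h1 h2 h2
          · exact le_rfl
          · exact absurd (not_lt.1 (Finset.mem_filter.1 h1).2) h2
          · exact abs_nonneg _
          · exact le_rfl

/-- The error of the leave-a-window-out estimator, split into the light and the heavy symbols.  A
symbol that occurs fewer than `m` times outside a window of size `τ ≤ m` occurs fewer than `3 * m`
times in total. -/
lemma sum_abs_countMass_sub_wingIt_le (hp : ∀ x, 0 ≤ p x) (hn : 1 ≤ n) {τ m : ℕ}
    (hτm : τ ≤ m) (z : Fin n → S) :
    ∑ ζ ∈ Finset.range m, |countMass p z ζ - wingIt τ z ζ| ≤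
      ∑ ζ ∈ Finset.range m, |1 / (n : ℝ) * ∑ i, localError p
        (Finset.univ.filter fun x => ¬ 6 * (m : ℝ) / n ≤ p x) i (indepSet τ i) Finset.univ ζ z| +
      2 * ∑ x, if 6 * (m : ℝ) / n ≤ p x ∧ count z x < 3 * m then p x else 0 := by
  have hn0 : (0 : ℝ) < n := by exact_mod_cast hn
  set L := Finset.univ.filter fun x => ¬ 6 * (m : ℝ) / n ≤ p x with hLdef
  set H := Finset.univ.filter fun x => 6 * (m : ℝ) / n ≤ p x with hHdef
  have hmemH : ∀ x, x ∈ H ↔ 6 * (m : ℝ) / n ≤ p x := fun x => by simp [hHdef]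
  -- the parts of the target and of the estimator that come from heavy symbols
  let U (ζ : ℕ) : ℝ := ∑ x ∈ H, p x * (if count z x = ζ then 1 else 0)
  let W (ζ : ℕ) : ℝ := 1 / (n : ℝ) * ∑ i, ∑ x ∈ H, (if z i = x then (1 : ℝ) else 0) *
    (if countOn z (indepSet τ i) x = ζ then 1 else 0)
  have hU0 : ∀ ζ, 0 ≤ U ζ := fun ζ =>
    Finset.sum_nonneg fun x _ => mul_nonneg (hp x) (boole_nonneg _)
  have hW0 : ∀ ζ, 0 ≤ W ζ := fun ζ => mul_nonneg (by positivity)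
    (Finset.sum_nonneg fun i _ => Finset.sum_nonneg fun x _ =>
      mul_nonneg (boole_nonneg _) (boole_nonneg _))
  have hsplit : ∀ f : S → ℝ, ∑ x, f x = ∑ x ∈ H, f x + ∑ x ∈ L, f x := fun f =>
    (Finset.sum_filter_add_sum_filter_not _ _ _).symm
  have hdecomp : ∀ ζ, countMass p z ζ - wingIt τ z ζ =
      -(1 / (n : ℝ) * ∑ i, localError p L i (indepSet τ i) Finset.univ ζ z) + (U ζ - W ζ) := by
    intro ζ
    have e1 : wingIt τ z ζ = 1 / (n : ℝ) * ∑ i, ∑ x, (if z i = x then (1 : ℝ) else 0) *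
        (if countOn z (indepSet τ i) x = ζ then 1 else 0) := by
      rw [wingIt]
      congr 1
      refine Finset.sum_congr rfl fun i _ => ?_
      rw [sum_ite_eq_symbol z i
        fun x => if countOn z (indepSet τ i) x = ζ then (1 : ℝ) else 0]
    have e2 : 1 / (n : ℝ) * ∑ i, localError p L i (indepSet τ i) Finset.univ ζ z =
        1 / (n : ℝ) * (∑ i, ∑ x ∈ L, (if z i = x then (1 : ℝ) else 0) *
          (if countOn z (indepSet τ i) x = ζ then 1 else 0)) -
        ∑ x ∈ L, p x * (if count z x = ζ then 1 else 0) := by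
      simp only [localError, Finset.sum_sub_distrib]
      rw [Finset.sum_const, Finset.card_univ, Fintype.card_fin, nsmul_eq_mul, mul_sub,
        ← mul_assoc (1 / (n : ℝ)) (n : ℝ), one_div_mul_cancel hn0.ne', one_mul]
      rfl
    rw [e1, e2, countMass, hsplit]
    simp_rw [hsplit (fun x => (if z _ = x then (1 : ℝ) else 0) * _)]
    rw [Finset.sum_add_distrib, mul_add]
    simp only [U, W]
    ring
  have hcount : ∀ x, (count z x : ℝ) = ∑ i, if z i = x then (1 : ℝ) else 0 := fun x => by
    rw [count, countOn_eq_sum]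
  have hUsum : ∑ ζ ∈ Finset.range m, U ζ ≤
      ∑ x, if 6 * (m : ℝ) / n ≤ p x ∧ count z x < 3 * m then p x else 0 := by
    simp only [U]
    rw [Finset.sum_comm, hHdef, Finset.sum_filter]
    refine Finset.sum_le_sum fun x _ => ?_
    rw [← Finset.mul_sum, Finset.sum_ite_eq]
    by_cases h1 : 6 * (m : ℝ) / n ≤ p x
    · by_cases h2 : count z x < m
      · have h3 : count z x < 3 * m := by omega
        simp [h1, h2, h3]
      · simp only [h1, Finset.mem_range, h2, if_true, if_false, mul_zero]
        split_ifs
        · exact hp x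
        · exact le_rfl
    · simp [h1]
  have hWsum : ∑ ζ ∈ Finset.range m, W ζ ≤
      ∑ x, if 6 * (m : ℝ) / n ≤ p x ∧ count z x < 3 * m then p x else 0 := by
    simp only [W]
    rw [← Finset.mul_sum, Finset.sum_comm]
    have e1 : ∀ i : Fin n, ∑ ζ ∈ Finset.range m, ∑ x ∈ H, (if z i = x then (1 : ℝ) else 0) *
        (if countOn z (indepSet τ i) x = ζ then 1 else 0) ≤
        ∑ x ∈ H, (if z i = x then (1 : ℝ) else 0) * (if count z x < 3 * m then 1 else 0) := by
      intro i
      rw [Finset.sum_comm]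
      refine Finset.sum_le_sum fun x _ => ?_
      rw [← Finset.mul_sum, Finset.sum_ite_eq]
      refine mul_le_mul_of_nonneg_left ?_ (boole_nonneg _)
      have h1 := countOn_add_countOn_sdiff z (Finset.subset_univ (indepSet τ i)) x
      have h2 : countOn z (Finset.univ \ indepSet τ i) x ≤ 2 * τ := by
        refine (Finset.card_filter_le _ _).trans (le_trans (le_of_eq ?_) (card_depSet_le τ i))
        rw [indepSet, ← Finset.compl_eq_univ_sdiff, compl_compl]
      have h3 : countOn z (indepSet τ i) x < m → count z x < 3 * m := by
        rw [count]
        omega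
      split_ifs with h4 h5 h5
      · exact le_rfl
      · exact absurd (h3 (Finset.mem_range.1 h4)) h5
      · norm_num
      · exact le_rfl
    refine (mul_le_mul_of_nonneg_left (Finset.sum_le_sum fun i _ => e1 i)
      (by positivity)).trans ?_
    rw [Finset.sum_comm, Finset.mul_sum, hHdef, Finset.sum_filter]
    refine Finset.sum_le_sum fun x _ => ?_
    rw [← Finset.sum_mul, ← hcount]
    by_cases h1 : 6 * (m : ℝ) / n ≤ p x
    · by_cases h2 : count z x < 3 * m
      · simp only [h1, h2, if_true, and_self, mul_one]
        refine le_trans ?_ h1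
        have : (count z x : ℝ) ≤ 6 * m := by
          have : count z x ≤ 6 * m := by omega
          exact_mod_cast this
        rw [one_div, inv_mul_eq_div]
        gcongr
      · simp [h2]
    · simp [h1]
  calc ∑ ζ ∈ Finset.range m, |countMass p z ζ - wingIt τ z ζ|
      ≤ ∑ ζ ∈ Finset.range m,
          (|1 / (n : ℝ) * ∑ i, localError p L i (indepSet τ i) Finset.univ ζ z| +
            (U ζ + W ζ)) := by
        refine Finset.sum_le_sum fun ζ _ => ?_
        rw [hdecomp]
        refine (abs_add_le _ _).trans (add_le_add (abs_neg _).le ?_)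
        have := hU0 ζ
        have := hW0 ζ
        exact abs_le.2 ⟨by linarith, by linarith⟩
    _ ≤ _ := by
        rw [Finset.sum_add_distrib, Finset.sum_add_distrib]
        linarith

end Deterministic

namespace IsMixingLaw

variable {n : ℕ} {S : Type*} [Fintype S] [DecidableEq S]
  {Q : (Fin n → S) → ℝ} {p : S → ℝ} {τ : ℕ} {κ : ℝ}

lemma mean_sum_abs_countMass_sub_wingIt_le (h : IsMixingLaw Q p τ κ) (hn : 1 ≤ n) {m : ℕ}
    (hm : 1 ≤ m) (hτm : τ ≤ m) {a : ℝ} (ha : 0 < a) :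
    mean Q (fun z => ∑ ζ ∈ Finset.range m, |countMass p z ζ - wingIt τ z ζ|) ≤
      a / 2 * (4 * τ / n + 24 * (κ * m ^ 3 * n ^ 2) + 24 * τ * (6 * m / n + κ)) + m / (2 * a) +
      2 * (2 * n / (3 * m) * (2 * τ / n + κ)) := by
  have hp := h.mass_nonneg hn
  have hn0 : (0 : ℝ) < n := by exact_mod_cast hn
  set L := Finset.univ.filter fun x => ¬ 6 * (m : ℝ) / n ≤ p x with hLdef
  have hL : ∀ x ∈ L, p x ≤ 6 * m / n := fun x hx => (not_le.1 (Finset.mem_filter.1 hx).2).le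
  have hsq := h.mean_sum_sq_localError_le (δ := 6 * m / n) (by positivity) hL hn m
  have hheavy := h.mean_heavy_le hn hm
  have pt : ∀ z : Fin n → S, ∑ ζ ∈ Finset.range m, |countMass p z ζ - wingIt τ z ζ| ≤
      (a / (2 * n ^ 2) * (∑ ζ ∈ Finset.range m,
        (∑ i, localError p L i (indepSet τ i) Finset.univ ζ z) ^ 2) + m / (2 * a)) +
      2 * ∑ x, if 6 * (m : ℝ) / n ≤ p x ∧ count z x < 3 * m then p x else 0 := by
    intro z
    refine (sum_abs_countMass_sub_wingIt_le hp hn hτm z).trans (add_le_add ?_ le_rfl)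
    have e : (m : ℝ) / (2 * a) = ∑ _ζ ∈ Finset.range m, 1 / (2 * a) := by
      rw [Finset.sum_const, Finset.card_range, nsmul_eq_mul]
      ring
    rw [e, Finset.mul_sum, ← Finset.sum_add_distrib]
    refine Finset.sum_le_sum fun ζ _ => ?_
    rw [← hLdef]
    generalize ∑ i, localError p L i (indepSet τ i) Finset.univ ζ z = y
    rw [abs_mul, abs_of_pos (by positivity : (0 : ℝ) < 1 / n), ← sq_abs y]
    have h1 : a / (2 * n ^ 2) * |y| ^ 2 + 1 / (2 * a) - 1 / n * |y| =
        (a * |y| / n - 1) ^ 2 / (2 * a) := by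
      field_simp
      ring
    have h2 : 0 ≤ (a * |y| / n - 1) ^ 2 / (2 * a) := by positivity
    linarith
  have h1 := mean_mono h.nonneg pt
  rw [mean_add, mean_add, mean_const_mul, mean_const_mul, mean_const h.sum_one] at h1
  refine h1.trans (add_le_add (add_le_add ?_ le_rfl) (by linarith))
  refine (mul_le_mul_of_nonneg_left hsq (by positivity)).trans (le_of_eq ?_)
  field_simp

/-- The expected error of the hybrid estimator with transition point `m - 1`, for `m` of order at
most `n ^ (1 / 3)`. -/
lemma mean_tvDist_hybrid_le (h : IsMixingLaw Q p τ κ) (hn : 1 ≤ n) {m : ℕ} (hm : 1 ≤ m)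
    (hmn : m ^ 3 ≤ n) (hτ : 1 ≤ τ) (hκ : κ ≤ 4 / n ^ 5) {r : ℝ} (hr : 0 < r)
    (hr2 : r ^ 2 = τ / m) :
    mean Q (fun z => tvDist n (countMass p z) (hybrid τ (m - 1) z)) ≤ 200 * r := by
  have hp := h.mass_nonneg hn
  have hp1 := h.mass_sum_one hn
  have hn1 : (1 : ℝ) ≤ n := by exact_mod_cast hn
  have hm1 : (1 : ℝ) ≤ m := by exact_mod_cast hm
  have hτ1 : (1 : ℝ) ≤ τ := by exact_mod_cast hτ
  have hmn' : (m : ℝ) ^ 3 ≤ n := by exact_mod_cast hmn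
  have hn0 : (0 : ℝ) < n := by linarith
  have hm0 : (0 : ℝ) < m := by linarith
  have hτ0 : (0 : ℝ) < τ := by linarith
  have hκ0 := h.kappa_nonneg
  rcases lt_or_ge m τ with hlt | hτm
  · have : 1 ≤ r := by
      have h1 : (1 : ℝ) ≤ r ^ 2 := by
        rw [hr2, one_le_div hm0]
        exact_mod_cast hlt.le
      nlinarith
    calc mean Q (fun z => tvDist n (countMass p z) (hybrid τ (m - 1) z)) ≤ mean Q (fun _ => 1) :=
          mean_mono h.nonneg fun z => tvDist_hybrid_le_one hp hp1 τ _ z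
      _ = 1 := mean_const h.sum_one 1
      _ ≤ 200 * r := by linarith
  have hr1 : r ≤ 1 := by
    have h1 : r ^ 2 ≤ 1 := by
      rw [hr2, div_le_one hm0]
      exact_mod_cast hτm
    nlinarith
  have hτr : (τ : ℝ) = r ^ 2 * m := by
    rw [hr2]
    field_simp
  have hκn : κ ≤ 4 * τ / n := by
    refine hκ.trans (div_le_div₀ (by positivity) (by linarith) hn0 ?_)
    exact le_self_pow₀ hn1 (by norm_num)
  have hvar : 2 * (τ : ℝ) / n + κ ≤ 6 * τ / n := by
    have : 6 * (τ : ℝ) / n = 2 * τ / n + 4 * τ / n := by ring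
    linarith
  have hV : 4 * (τ : ℝ) / n + 24 * (κ * m ^ 3 * n ^ 2) + 24 * τ * (6 * m / n + κ) ≤
      340 * (τ * m / n) := by
    have h1 : 4 * (τ : ℝ) / n ≤ 4 * (τ * m / n) := by
      rw [← mul_div_assoc]
      gcongr
      nlinarith
    have h2 : κ * m ^ 3 * (n : ℝ) ^ 2 ≤ 4 * (τ * m / n) := by
      calc κ * (m : ℝ) ^ 3 * (n : ℝ) ^ 2 ≤ 4 / (n : ℝ) ^ 5 * n * (n : ℝ) ^ 2 := by gcongr
        _ = 4 * (1 / (n : ℝ) ^ 2) := by field_simp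
        _ ≤ 4 * ((τ : ℝ) * m / n) := by
          gcongr
          · nlinarith
          · exact le_self_pow₀ hn1 (by norm_num)
    have h3 : κ ≤ 4 * (m / n) := by
      rw [← mul_div_assoc]
      refine hκ.trans (div_le_div₀ (by positivity) (by linarith) hn0 ?_)
      exact le_self_pow₀ hn1 (by norm_num)
    have h4 : 24 * τ * (6 * m / n + κ) ≤ 240 * (τ * m / n) := by
      calc 24 * τ * (6 * m / n + κ) ≤ 24 * τ * (6 * m / n + 4 * (m / n)) := by gcongr
        _ = 240 * (τ * m / n) := by ring
    linarith
  -- both weights are chosen so that the two terms of each mean inequality balance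
  have hsmall := h.mean_sum_abs_countMass_sub_wingIt_le hn hm hτm (a := m / r) (by positivity)
  have hfreq := h.mean_frequent_le hn hm (a := n / (m * r)) (by
    gcongr
    exact mul_le_of_le_one_right hm0.le hr1)
  have hs1 : m / r / 2 * (4 * τ / n + 24 * (κ * m ^ 3 * n ^ 2) + 24 * τ * (6 * m / n + κ)) ≤
      170 * r := by
    calc m / r / 2 * (4 * τ / n + 24 * (κ * m ^ 3 * n ^ 2) + 24 * τ * (6 * m / n + κ))
        ≤ m / r / 2 * (340 * (τ * m / n)) := by gcongr
      _ = 170 * r * (m ^ 3 / n) := by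
        rw [hτr]
        field_simp
        norm_num
      _ ≤ 170 * r := mul_le_of_le_one_right (by positivity) ((div_le_one hn0).2 hmn')
  have hs2 : m / (2 * (m / r)) = r / 2 := by field_simp
  have hs3 : 2 * (2 * n / (3 * m) * (2 * τ / n + κ)) ≤ 8 * r := by
    calc 2 * (2 * n / (3 * m) * (2 * τ / n + κ)) ≤ 2 * (2 * n / (3 * m) * (6 * τ / n)) := by gcongr
      _ = 8 * r * r := by
        rw [hτr]
        field_simp
        norm_num
      _ ≤ 8 * r := mul_le_of_le_one_right (by positivity) hr1
  have hf1 : 2 * (n / (m * r)) * (2 * τ / n + κ) ≤ 12 * r := by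
    calc 2 * (n / (m * r)) * (2 * τ / n + κ) ≤ 2 * (n / (m * r)) * (6 * τ / n) := by gcongr
      _ = 12 * r := by
        rw [hτr]
        field_simp
        norm_num
  have hf2 : n / (m * (n / (m * r))) = r := by field_simp
  have htot := mean_mono h.nonneg fun z => (tvDist_hybrid_le hp hp1 τ (m - 1) z).trans
    (sum_abs_countMass_sub_hybridRaw_le τ hm z)
  rw [mean_add] at htot
  linarith

end IsMixingLaw

/-! ### The law of the sample of a mixing process -/

/-- A linear functional of size at most `κ` at the indicators of events determined by the
coordinates in `s` is of size at most `2 * κ * B` at the functions of these coordinates bounded by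
`B`: split the level sets of the function according to the sign of the functional. -/
lemma abs_le_of_abs_indicator_le {n : ℕ} {S : Type*} [Fintype S] {s : Set (Fin n)} {κ B : ℝ}
    (l : ((Fin n → S) → ℝ) →ₗ[ℝ] ℝ)
    (hl : ∀ f : (Fin n → S) → ℝ, DependsOn f s → (∀ z, f z = 0 ∨ f z = 1) → |l f| ≤ κ)
    {u : (Fin n → S) → ℝ} (hu : DependsOn u s) (hB0 : 0 ≤ B) (hB : ∀ z, |u z| ≤ B) :
    |l u| ≤ 2 * κ * B := by
  classical
  let V : Finset ℝ := Finset.univ.image u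
  have hV : ∀ z, u z ∈ V := fun z => Finset.mem_image_of_mem u (Finset.mem_univ z)
  let level (c : ℝ) : (Fin n → S) → ℝ := fun z => if u z = c then 1 else 0
  have hunion : ∀ W : Finset ℝ, |∑ c ∈ W, l (level c)| ≤ κ := by
    intro W
    rw [← map_sum]
    have e : ∑ c ∈ W, level c = fun z => if u z ∈ W then (1 : ℝ) else 0 := by
      funext z
      simp [level]
    rw [e]
    refine hl _ ?_ fun z => ?_
    · intro z z' hz
      simp only [hu hz]
    · split_ifs <;> simp
  have hdecomp : u = ∑ c ∈ V, c • level c := by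
    funext z
    simp [level, hV z]
  have h1 : |l u| ≤ B * ∑ c ∈ V, |l (level c)| := by
    conv_lhs => rw [hdecomp]
    rw [map_sum, Finset.mul_sum]
    refine (Finset.abs_sum_le_sum_abs _ _).trans (Finset.sum_le_sum fun c hc => ?_)
    obtain ⟨z, -, rfl⟩ := Finset.mem_image.1 hc
    rw [map_smul, smul_eq_mul, abs_mul]
    exact mul_le_mul_of_nonneg_right (hB z) (abs_nonneg _)
  have h2 : ∑ c ∈ V, |l (level c)| ≤ 2 * κ := by
    rw [← Finset.sum_filter_add_sum_filter_not V (fun c => 0 ≤ l (level c))]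
    have e1 : ∑ c ∈ V.filter (fun c => 0 ≤ l (level c)), |l (level c)| =
        ∑ c ∈ V.filter (fun c => 0 ≤ l (level c)), l (level c) :=
      Finset.sum_congr rfl fun c hc => abs_of_nonneg (Finset.mem_filter.1 hc).2
    have e2 : ∑ c ∈ V.filter (fun c => ¬ 0 ≤ l (level c)), |l (level c)| =
        -∑ c ∈ V.filter (fun c => ¬ 0 ≤ l (level c)), l (level c) := by
      rw [← Finset.sum_neg_distrib]
      exact Finset.sum_congr rfl fun c hc =>
        abs_of_neg (not_le.1 (Finset.mem_filter.1 hc).2)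
    rw [e1, e2]
    have a1 := (abs_le.1 (hunion (V.filter fun c => 0 ≤ l (level c)))).2
    have a2 := (abs_le.1 (hunion (V.filter fun c => ¬ 0 ≤ l (level c)))).1
    linarith
  exact h1.trans ((mul_le_mul_of_nonneg_left h2 hB0).trans_eq (by ring))

lemma mixTime_spec {Ω S : Type*} [MeasurableSpace Ω] [MeasurableSpace S] {P : Measure Ω}
    {X : ℕ → Ω → S} (h : IsExpAlphaMixing P X) {ε : ℝ} (hε : 0 < ε) :
    1 ≤ mixTime P X ε ∧ alphaMix P X (mixTime P X ε) ≤ ε := by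
  obtain ⟨m, ρ, hm, hρ, hρ1, hα⟩ := h
  refine Nat.sInf_mem (s := {τ : ℕ | 1 ≤ τ ∧ alphaMix P X τ ≤ ε}) ?_
  obtain ⟨k, hk⟩ := exists_pow_lt_of_lt_one (show 0 < ε / m by positivity) hρ1
  refine ⟨k + 1, Nat.le_add_left 1 k, (hα (k + 1) (Nat.le_add_left 1 k)).trans ?_⟩
  have h1 : ρ ^ (k + 1) ≤ ε / m := (pow_le_pow_of_le_one hρ.le hρ1.le (Nat.le_succ k)).trans hk.le
  calc m * ρ ^ (k + 1) ≤ m * (ε / m) := mul_le_mul_of_nonneg_left h1 hm.le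
    _ = ε := by field_simp

/-- An event determined by coordinates of the sample belongs to every σ-algebra that makes these
coordinates measurable. -/
lemma measurableSet_of_dependsOn {Ω S : Type*} [Fintype S] [MeasurableSpace S]
    [MeasurableSingletonClass S] {X : ℕ → Ω → S} {n : ℕ} {s : Set (Fin n)} {f : (Fin n → S) → ℝ}
    (hf : DependsOn f s) (𝓕 : MeasurableSpace Ω) (h : ∀ k ∈ s, Measurable[𝓕] (X k)) :
    MeasurableSet[𝓕] {ω | f (sample X n ω) = 1} := by
  classical
  rcases isEmpty_or_nonempty Ω with hΩ | ⟨⟨ω₀⟩⟩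
  · rw [Set.eq_empty_of_isEmpty {ω | f (sample X n ω) = 1}]
    exact @MeasurableSet.empty _ 𝓕
  -- freezing the remaining coordinates does not affect the event
  let Y (ω : Ω) : Fin n → S := fun k => if k ∈ s then X k ω else X k ω₀
  have hY : Measurable[𝓕] Y := by
    refine @measurable_pi_iff _ _ _ 𝓕 _ _ |>.2 fun k => ?_
    by_cases hk : k ∈ s
    · simpa only [Y, hk, if_true] using h k hk
    · simp only [Y, hk, if_false]
      exact @measurable_const _ _ _ 𝓕 _
  have e : {ω | f (sample X n ω) = 1} = Y ⁻¹' {z | f z = 1} := by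
    ext ω
    have : f (sample X n ω) = f (Y ω) := hf fun k hk => by simp [Y, hk, sample]
    simp only [Set.mem_ofPred_eq, Set.mem_preimage, this]
  rw [e]
  exact hY (Set.toFinite {z | f z = 1}).measurableSet

section SampleLaw

variable {Ω S : Type*} [MeasurableSpace Ω] {P : Measure Ω} [IsProbabilityMeasure P]
  [MeasurableSpace S] {X : ℕ → Ω → S}

lemma alphaMix_bddAbove (P : Measure Ω) [IsProbabilityMeasure P] (X : ℕ → Ω → S) (τ : ℕ) :
    BddAbove {r : ℝ | ∃ (t : ℕ) (A B : Set Ω), MeasurableSet[pastSigma X t] A ∧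
      MeasurableSet[futureSigma X (t + τ)] B ∧ r = |P.real (A ∩ B) - P.real A * P.real B|} := by
  refine ⟨1, ?_⟩
  rintro r ⟨t, A, B, -, -, rfl⟩
  have h1 : P.real (A ∩ B) ≤ 1 := measureReal_le_one
  have h2 : P.real A ≤ 1 := measureReal_le_one
  have h3 : P.real B ≤ 1 := measureReal_le_one
  have h4 : 0 ≤ P.real (A ∩ B) := measureReal_nonneg
  have h5 : 0 ≤ P.real A := measureReal_nonneg
  have h6 : 0 ≤ P.real B := measureReal_nonneg
  have h7 : P.real A * P.real B ≤ 1 := mul_le_one₀ h2 h6 h3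
  have h8 : 0 ≤ P.real A * P.real B := mul_nonneg h5 h6
  exact abs_le.2 ⟨by linarith, by linarith⟩

lemma abs_measureReal_inter_sub_le {t τ : ℕ} {A B : Set Ω} (hA : MeasurableSet[pastSigma X t] A)
    (hB : MeasurableSet[futureSigma X (t + τ)] B) :
    |P.real (A ∩ B) - P.real A * P.real B| ≤ alphaMix P X τ :=
  le_csSup (alphaMix_bddAbove P X τ) ⟨t, A, B, hA, hB, rfl⟩

lemma alphaMix_nonneg (τ : ℕ) : 0 ≤ alphaMix P X τ :=
  (abs_nonneg _).trans (abs_measureReal_inter_sub_le (t := 0) (A := ∅) (B := ∅)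
    (@MeasurableSet.empty _ (pastSigma X 0)) (@MeasurableSet.empty _ (futureSigma X (0 + τ))))

lemma alphaMix_antitone {τ τ' : ℕ} (h : τ ≤ τ') : alphaMix P X τ' ≤ alphaMix P X τ := by
  refine csSup_le_csSup (alphaMix_bddAbove P X τ) ⟨_, 0, ∅, ∅,
    @MeasurableSet.empty _ (pastSigma X 0), @MeasurableSet.empty _ (futureSigma X (0 + τ')), rfl⟩ ?_
  rintro r ⟨t, A, B, hA, hB, rfl⟩
  have hle : futureSigma X (t + τ') ≤ futureSigma X (t + τ) :=
    biSup_mono fun s hs => le_trans (Nat.add_le_add_left h t) hs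
  exact ⟨t, A, B, hA, hle _ hB, rfl⟩

/-- The probability mass function of the sample of length `n`. -/
noncomputable def sampleLaw (P : Measure Ω) (X : ℕ → Ω → S) (n : ℕ) (z : Fin n → S) : ℝ :=
  (P.map (sample X n)).real {z}

lemma measurable_sample (hX : ∀ t, Measurable (X t)) (n : ℕ) : Measurable (sample X n) :=
  measurable_pi_iff.2 fun i => hX i

variable [Fintype S] [MeasurableSingletonClass S]

lemma mean_sampleLaw (hX : ∀ t, Measurable (X t)) (n : ℕ) (g : (Fin n → S) → ℝ) :
    mean (sampleLaw P X n) g = ∫ ω, g (sample X n ω) ∂P := by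
  classical
  have hs := measurable_sample hX n
  have := Measure.isProbabilityMeasure_map (μ := P) hs.aemeasurable
  rw [← integral_map hs.aemeasurable (Measurable.of_discrete (f := g)).aestronglyMeasurable,
    integral_fintype Integrable.of_finite]
  rfl

lemma mean_sampleLaw_indicator (hX : ∀ t, Measurable (X t)) (n : ℕ) {f : (Fin n → S) → ℝ}
    (hf : ∀ z, f z = 0 ∨ f z = 1) :
    mean (sampleLaw P X n) f = P.real {ω | f (sample X n ω) = 1} := by
  classical
  rw [mean_sampleLaw hX]
  have hm : MeasurableSet {ω | f (sample X n ω) = 1} :=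
    measurable_sample hX n (Set.toFinite {z | f z = 1}).measurableSet
  rw [← integral_indicator_one hm]
  congr 1
  funext ω
  rcases hf (sample X n ω) with h | h <;> simp [Set.indicator, h]

variable [DecidableEq S]

/-- The sample of a stationary process has a mixing law; the factor `4` is the price of passing from
events to bounded functions. -/
lemma isMixingLaw_sampleLaw (hX : ∀ t, Measurable (X t)) (hs : IsStationary P X) (n τ : ℕ) :
    IsMixingLaw (sampleLaw P X n) (stationaryMass P X) τ (4 * alphaMix P X τ) := by
  have hsm := measurable_sample hX n
  have hprob := Measure.isProbabilityMeasure_map (μ := P) hsm.aemeasurable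
  refine ⟨fun z => measureReal_nonneg, ?_, ?_, ?_⟩
  · have := mean_sampleLaw (P := P) hX n fun _ => 1
    simpa [mean] using this
  · intro i x
    rw [mean_sampleLaw_indicator hX n fun z => by split_ifs <;> simp]
    have hset : {ω | (if sample X n ω i = x then (1 : ℝ) else 0) = 1} = {ω | X i ω = x} := by
      ext ω
      by_cases hω : X i ω = x <;> simp [sample, hω]
    rw [hset, stationaryMass]
    have hm : ∀ k : ℕ, Measurable fun ω (t : ℕ) => X (t + k) ω := fun k =>
      measurable_pi_iff.2 fun t => hX (t + k)
    have hB : MeasurableSet {w : ℕ → S | w 0 = x} :=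
      measurable_pi_apply (X := fun _ : ℕ => S) 0 (MeasurableSet.singleton x)
    have h1 := congrArg (fun μ : Measure (ℕ → S) => μ.real {w : ℕ → S | w 0 = x}) (hs i)
    simp only [map_measureReal_apply (hm i) hB] at h1
    rw [map_measureReal_apply (by simpa using hm 0) hB] at h1
    simpa using h1
  · intro b u v hu hv A B hA hB
    obtain ⟨z₀⟩ : Nonempty (Fin n → S) := (nonempty_of_isProbabilityMeasure P).map (sample X n)
    have hA0 : 0 ≤ A := (abs_nonneg _).trans (hA z₀)
    have hB0 : 0 ≤ B := (abs_nonneg _).trans (hB z₀)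
    set Q := sampleLaw P X n with hQ
    have hQ1 : ∑ z, Q z = 1 := by
      have := mean_sampleLaw (P := P) hX n fun _ => 1
      simpa [mean] using this
    let cov : ((Fin n → S) → ℝ) →ₗ[ℝ] ((Fin n → S) → ℝ) →ₗ[ℝ] ℝ :=
      LinearMap.mk₂ ℝ (fun f g => mean Q (fun z => f z * g z) - mean Q f * mean Q g)
        (fun f f' g => by
          have e1 : mean Q (f + f') = mean Q f + mean Q f' := mean_add f f'
          simp only [Pi.add_apply, add_mul, mean_add, e1]
          ring)
        (fun c f g => by
          have e1 : mean Q (c • f) = c * mean Q f := mean_const_mul c f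
          simp only [Pi.smul_apply, smul_eq_mul, mul_assoc, mean_const_mul, e1]
          ring)
        (fun f g g' => by
          have e1 : mean Q (g + g') = mean Q g + mean Q g' := mean_add g g'
          simp only [Pi.add_apply, mul_add, mean_add, e1]
          ring)
        (fun c f g => by
          have e1 : mean Q (c • g) = c * mean Q g := mean_const_mul c g
          simp only [Pi.smul_apply, smul_eq_mul, mul_left_comm _ c, mean_const_mul, e1]
          ring)
    have hevents : ∀ f g : (Fin n → S) → ℝ, DependsOn f {k : Fin n | (k : ℕ) + τ ≤ b} →
        DependsOn g {k : Fin n | b ≤ (k : ℕ)} → (∀ z, f z = 0 ∨ f z = 1) →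
        (∀ z, g z = 0 ∨ g z = 1) → |cov f g| ≤ alphaMix P X τ := by
      intro f g hf hg hf1 hg1
      change |mean Q (fun z => f z * g z) - mean Q f * mean Q g| ≤ _
      rcases lt_or_ge b τ with hb | hb
      · -- the earlier block is empty, so that `f` is constant
        have hconst : f = fun _ => f z₀ := by
          funext z
          refine hf fun k hk => ?_
          simp only [Set.mem_ofPred_eq] at hk
          omega
        rw [hconst, mean_const_mul, mean_const hQ1, sub_self, abs_zero]
        exact alphaMix_nonneg τ
      · have hfg : ∀ z, f z * g z = 0 ∨ f z * g z = 1 := by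
          intro z
          rcases hf1 z with h | h <;> rcases hg1 z with h' | h' <;> simp [h, h']
        rw [hQ, mean_sampleLaw_indicator hX n hfg, mean_sampleLaw_indicator hX n hf1,
          mean_sampleLaw_indicator hX n hg1]
        have hset : {ω | f (sample X n ω) * g (sample X n ω) = 1} =
            {ω | f (sample X n ω) = 1} ∩ {ω | g (sample X n ω) = 1} := by
          ext ω
          rcases hf1 (sample X n ω) with h | h <;> rcases hg1 (sample X n ω) with h' | h' <;>
            simp [h, h']
        rw [hset]
        refine abs_measureReal_inter_sub_le (t := b - τ) ?_ ?_
        · refine measurableSet_of_dependsOn hf _ fun k hk => ?_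
          have hk' : (k : ℕ) ∈ Set.Iic (b - τ) := by
            simp only [Set.mem_ofPred_eq] at hk
            simp only [Set.mem_Iic]
            omega
          exact (comap_measurable (X k)).mono
            (le_biSup (fun s => MeasurableSpace.comap (X s) inferInstance) hk') le_rfl
        · refine measurableSet_of_dependsOn hg _ fun k hk => ?_
          have hk' : (k : ℕ) ∈ Set.Ici (b - τ + τ) := by
            simp only [Set.mem_ofPred_eq] at hk
            simp only [Set.mem_Ici]
            omega
          exact (comap_measurable (X k)).mono
            (le_biSup (fun s => MeasurableSpace.comap (X s) inferInstance) hk') le_rfl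
    have h1 : ∀ g : (Fin n → S) → ℝ, DependsOn g {k : Fin n | b ≤ (k : ℕ)} →
        (∀ z, g z = 0 ∨ g z = 1) → |cov u g| ≤ 2 * alphaMix P X τ * A := fun g hg hg1 =>
      abs_le_of_abs_indicator_le (cov.flip g) (fun f hf hf1 => hevents f g hf hg hf1 hg1) hu hA0 hA
    have h2 := abs_le_of_abs_indicator_le (cov u) h1 hv hB0 hB
    exact h2.trans_eq (by ring)

end SampleLaw

end CountMass

/-! ### The risk of the hybrid estimator -/

theorem theorem1 :
    ∃ C : ℝ, 0 < C ∧
      ∀ (Ω : Type*) [MeasurableSpace Ω] (P : Measure Ω) [IsProbabilityMeasure P]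
        (S : Type*) [Fintype S] [DecidableEq S] [MeasurableSpace S] [MeasurableSingletonClass S]
        (X : ℕ → Ω → S),
        (∀ t, Measurable (X t)) →
        CountMass.IsStationary P X →
        CountMass.IsExpAlphaMixing P X →
        ∀ n : ℕ, 1 ≤ n →
        ∀ τ : ℕ, CountMass.mixTime P X ((n : ℝ) ^ (-5 : ℤ)) ≤ τ →
          CountMass.risk P X n
              (CountMass.hybrid τ (⌊(n : ℝ) ^ (1 / 3 : ℝ)⌋₊ - 1)) ≤
            C * (Real.sqrt ((τ : ℝ) * Real.log (C * (n : ℝ))) / (n : ℝ) ^ (1 / 6 : ℝ)) := by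
  refine ⟨300, by norm_num, ?_⟩
  intro Ω _ P _ S _ _ _ _ X hX hstat hmix n hn τ hτ
  have hn1 : (1 : ℝ) ≤ n := by exact_mod_cast hn
  have hn0 : (0 : ℝ) < n := by linarith
  obtain ⟨hmix1, hmix2⟩ := CountMass.mixTime_spec hmix
    (show (0 : ℝ) < (n : ℝ) ^ (-5 : ℤ) by positivity)
  have hτ1 : 1 ≤ τ := hmix1.trans hτ
  have hα : CountMass.alphaMix P X τ ≤ (n : ℝ) ^ (-5 : ℤ) :=
    (CountMass.alphaMix_antitone hτ).trans hmix2
  have hκ : 4 * CountMass.alphaMix P X τ ≤ 4 / (n : ℝ) ^ 5 := by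
    have e : (n : ℝ) ^ (-5 : ℤ) = 1 / (n : ℝ) ^ 5 := by
      rw [zpow_neg, one_div]
      norm_cast
    rw [e] at hα
    calc 4 * CountMass.alphaMix P X τ ≤ 4 * (1 / (n : ℝ) ^ 5) := by linarith
      _ = 4 / (n : ℝ) ^ 5 := by ring
  set y := (n : ℝ) ^ (1 / 3 : ℝ) with hy
  set m := ⌊y⌋₊ with hmdef
  have hy1 : 1 ≤ y := Real.one_le_rpow hn1 (by norm_num)
  have hm1 : 1 ≤ m := Nat.one_le_floor_iff _ |>.2 hy1
  have hm1' : (1 : ℝ) ≤ m := by exact_mod_cast hm1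
  have hmy : (m : ℝ) ≤ y := Nat.floor_le (by linarith)
  have hy3 : y ^ 3 = n := by
    rw [hy, ← Real.rpow_natCast, ← Real.rpow_mul hn0.le]
    norm_num
  have hmn : m ^ 3 ≤ n := by
    have : (m : ℝ) ^ 3 ≤ n := by
      rw [← hy3]
      gcongr
    exact_mod_cast this
  have hym : y ≤ 2 * m := by
    have := Nat.lt_floor_add_one y
    linarith
  have hτ0 : (0 : ℝ) < τ := by exact_mod_cast hτ1
  set w := (n : ℝ) ^ (1 / 6 : ℝ) with hw
  have hw0 : 0 < w := by positivity
  have hw2 : w ^ 2 = y := by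
    rw [hw, ← Real.rpow_natCast, ← Real.rpow_mul hn0.le, hy]
    norm_num
  have hbound := (CountMass.isMixingLaw_sampleLaw hX hstat n τ).mean_tvDist_hybrid_le hn hm1 hmn
    hτ1 hκ (r := Real.sqrt (τ / m)) (by positivity) (Real.sq_sqrt (by positivity))
  rw [CountMass.mean_sampleLaw hX] at hbound
  have hrisk : CountMass.risk P X n (CountMass.hybrid τ (m - 1)) ≤
      200 * Real.sqrt (τ / m) := hbound
  refine hrisk.trans ?_
  have hlog : 1 ≤ Real.log (300 * (n : ℝ)) := by
    rw [Real.le_log_iff_exp_le (by positivity)]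
    have := Real.exp_one_lt_d9
    linarith
  have h1 : Real.sqrt τ ≤ Real.sqrt (τ * Real.log (300 * (n : ℝ))) :=
    Real.sqrt_le_sqrt (le_mul_of_one_le_right hτ0.le hlog)
  -- `m` is the integer part of `w ^ 2`, so that `w ^ 2 ≤ 2 * m`
  have h2 : Real.sqrt (τ / m) ≤ 3 / 2 * (Real.sqrt τ / w) := by
    refine Real.sqrt_le_iff.2 ⟨by positivity, ?_⟩
    rw [mul_pow, div_pow (Real.sqrt τ), Real.sq_sqrt hτ0.le, hw2, ← mul_div_assoc, div_le_div_iff₀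
      (by positivity) (by positivity)]
    nlinarith
  have h3 : Real.sqrt τ / w ≤ Real.sqrt (τ * Real.log (300 * (n : ℝ))) / w := by gcongr
  linarith
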